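/- **Theorem (magic formula for the arboreal gas).** Let $G=(\Lambda,E)$ be a finite connected (simple, undirected) graph and let $\beta>0$. The arboreal gas $\mathbb P_\beta$ is the probability measure on edge sets $F\subseteq E$ given by $$\mathbb P_\beta[F]=\frac{1}{Z^{\mathrm{for}}_\beta}\,\beta^{|F|}\,\mathbf 1\big((\Lambda,F)\text{ is acyclic}\big),\qquad Z^{\mathrm{for}}_\beta=\sum_{F\subseteq E,\ (\Lambda,F)\text{ acyclic}}\beta^{|F|},$$ and $\{i\leftrightarrow j\}$ is the event that $i$ and $j$ lie in the same connected component of $(\Lambda,F)$. Fix a vertex $0\in\Lambda$. For $t\in\mathbb R^{\Lambda\setminus 0}$ put $t_0=0$, let $-\Delta_{\beta(t)}$ be the $\Lambda\times\Lambda$ matrix acting by $$(-\Delta_{\beta(t)}f)_i=-\sum_{k\sim i}\beta e^{t_i+t_k}(f_k-f_i),$$ and let ${\det}^0(-\Delta_{\beta(t)})$ be any principal cofactor of it, i.e. the determinant of the matrix with the row and column of some vertex $v$ removed; the statement holds for each choice of $v\in\Lambda$. Let $$\rho(t)=e^{-\frac\beta2\sum_{i\in\Lambda}\sum_{k\sim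 i}\cosh(t_i-t_k)}\,\big({\det}^0(-\Delta_{\beta(t)})\big)^{3/2}\prod_{k\in\Lambda\setminus 0}e^{-3t_k},\qquad Z_\beta=(2\pi)^{\frac{|\Lambda|-1}{2}}\,e^{-\beta|E|}\,Z^{\mathrm{for}}_\beta .$$ Then $\rho$ and, for every $j\in\Lambda$, the function $t\mapsto e^{t_j}\rho(t)$ are Lebesgue integrable on $\mathbb R^{\Lambda\setminus 0}$, the constant $Z_\beta$ is the total mass of $\rho$, $$Z_\beta=\int_{\mathbb R^{\Lambda\setminus 0}}\rho(t)\prod_{k\in\Lambda\setminus 0}dt_k,$$ and for every $j\in\Lambda$ $$\mathbb P_\beta[0\leftrightarrow j]=\frac1{Z_\beta}\int_{\mathbb R^{\Lambda\setminus 0}}e^{t_j}\,e^{-\frac\beta2\sum_{i\in\Lambda}\sum_{k\sim i}\cosh(t_i-t_k)}\,\big({\det}^0(-\Delta_{\beta(t)})\big)^{3/2}\prod_{k\in\Lambda\setminus 0}e^{-3t_k}\,dt_k .$$ -/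

import Mathlib

open MeasureTheory

namespace ArborealGas

variable {V : Type*} [Fintype V] [DecidableEq V] (G : SimpleGraph V) [DecidableRel G.Adj]

/-- A set `F` of edges, read as the spanning subgraph `(V, F)`, is a forest of `G`:
all its edges are edges of `G` and it has no cycle. -/
def IsForest (F : Finset (Sym2 V)) : Prop :=
  F ⊆ G.edgeFinset ∧ (SimpleGraph.fromEdgeSet (F : Set (Sym2 V))).IsAcyclic

open Classical in
/-- The weight `β ^ |F| * 1(F is a forest)` of an edge set `F`. -/
noncomputable def weight (β : ℝ) (F : Finset (Sym2 V)) : ℝ :=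
  if IsForest G F then β ^ F.card else 0

/-- The partition function of the arboreal gas. -/
noncomputable def partitionFunction (β : ℝ) : ℝ :=
  ∑ F ∈ G.edgeFinset.powerset, weight G β F

open Classical in
/-- The probability of an event `A` (a set of edge sets) under the arboreal gas measure. -/
noncomputable def prob (β : ℝ) (A : Set (Finset (Sym2 V))) : ℝ :=
  (∑ F ∈ G.edgeFinset.powerset with F ∈ A, weight G β F) / partitionFunction G β

/-- The event that `i` and `j` lie in the same connected component of `(V, F)`. -/
def connectionEvent (i j : V) : Set (Finset (Sym2 V)) :=
  {F | (SimpleGraph.fromEdgeSet (F : Set (Sym2 V))).Reachable i j}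

/-- The configuration on `V` obtained from `t` on `V ∖ {o}` by pinning the value `0` at `o`. -/
def pin (o : V) (t : {k : V // k ≠ o} → ℝ) (i : V) : ℝ :=
  if h : i = o then 0 else t ⟨i, h⟩

/-- The matrix of the negative graph Laplacian with edge weights `β * exp (t i + t j)`. -/
noncomputable def negLaplacian (β : ℝ) (t : V → ℝ) : Matrix V V ℝ :=
  Matrix.of fun i j =>
    if i = j then ∑ k ∈ G.neighborFinset i, β * Real.exp (t i + t k)
    else if G.Adj i j then -(β * Real.exp (t i + t j)) else 0

/-- The matrix acts on functions as the negative weighted Laplacian. -/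
theorem negLaplacian_mulVec (β : ℝ) (t f : V → ℝ) (i : V) :
    (negLaplacian G β t).mulVec f i =
      -∑ j ∈ G.neighborFinset i, β * Real.exp (t i + t j) * (f j - f i) := by
  have h : ∀ j : V, negLaplacian G β t i j * f j =
      (if i = j then (∑ k ∈ G.neighborFinset i, β * Real.exp (t i + t k)) * f i else 0) -
        (if j ∈ G.neighborFinset i then β * Real.exp (t i + t j) * f j else 0) := by
    intro j
    by_cases hij : i = j
    · subst hij
      simp [negLaplacian]
    · by_cases ha : G.Adj i j <;> simp [negLaplacian, hij, ha]
  simp only [Matrix.mulVec, dotProduct, h, Finset.sum_sub_distrib]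
  simp [mul_sub, Finset.sum_sub_distrib, Finset.sum_mul, ← Finset.sum_filter,
    SimpleGraph.neighborFinset_eq_filter]

/-- The principal cofactor of `A` at `v`: the determinant of `A` with the row and the column
indexed by `v` removed. -/
noncomputable def principalCofactor (A : Matrix V V ℝ) (v : V) : ℝ :=
  (A.submatrix (fun k : {k : V // k ≠ v} => (k : V)) (fun k : {k : V // k ≠ v} => (k : V))).det

/-- The density, with respect to Lebesgue measure on `ℝ ^ (V ∖ {o})`, of the (unnormalised)
law of the `t`-field pinned at `o`, where the determinant is the principal cofactor at `v`.
The double sum runs over ordered pairs of adjacent vertices. -/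
noncomputable def density (β : ℝ) (o v : V) (t : {k : V // k ≠ o} → ℝ) : ℝ :=
  Real.exp (-(β / 2) * ∑ i, ∑ k ∈ G.neighborFinset i, Real.cosh (pin o t i - pin o t k)) *
    principalCofactor (negLaplacian G β (pin o t)) v ^ (3 / 2 : ℝ) *
    ∏ k : {k : V // k ≠ o}, Real.exp (-3 * t k)

end ArborealGas

/-!
The exponent `3/2` of the determinant splits as `1/2 + 1`. With the exponent `1/2`, and `e^{-t_k}` in
place of `e^{-3 t_k}`, the density is that of the `t`-field of the `H^{2|2}` model (`tDensity`), and
the remaining factor is the determinant, away from the pinned vertex `o`, of the operator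
`diag(u) - w`, where `w` are the edge weights and `u_i = ∑_k w_{ik} e^{t_k - t_i}` (`density_eq`). So
the partition function is the expectation of this determinant in the `H^{2|2}` model, and the
connection probability is the same expectation weighted by `e^{t_j}`.

The `H^{2|2}` density has the explicit total mass `(2π)^{(|V|-1)/2}`, even when weighted by `e^{t_l}`:
integrating out the coordinate of one vertex produces the same density for the Schur complement, by
a one-dimensional Gaussian integral (`lintegral_pinnedDensity_fin`). Tilting by a multiple of `u_j`
only translates the `t`-field and rescales the weights at `j`, so the total mass gives the Laplace
transform of `u`, and by differentiation its moments, which are matching polynomials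
(`integral_prod_tField`). As `det (diag u - w)` is multi-affine in `u`, its expectation is an explicit
polynomial `expDet` in the weights.

This polynomial is the forest generating function because it satisfies the deletion–contraction
recursion (`expDet_add_edge`). With an endpoint `p` of the edge `pq` pinned, the weight of `pq` enters
only through the mean of `u_q`, in which the expected determinant is affine, and its slope is the
expected determinant with both `p` and `q` removed, which is that of the contracted graph. That any
vertex may be taken as the pinned one (`expDet_eq_erase`) follows from `det (diag u - w) = 0` on the
whole vertex set, the vector `e^t` being in the kernel.

Weighting by `e^{t_j}` lowers the mean of `u_j` by one, hence subtracts the expected determinant of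
the graph in which `o` and `j` are identified, and that is the sum over the forests which do not
connect `o` and `j` (`forestSum_eq`, `sum_weight_connectionEvent`).
-/

namespace ArborealGas

/-! ### A one-dimensional integral -/

/-- The Gaussian density at the point `a e^{s/2} - e^{-s/2}`. -/
noncomputable def sinhGaussian (a s : ℝ) : ℝ :=
  Real.exp (-(1 / 2) * (a * Real.exp (s / 2) - Real.exp (-s / 2)) ^ 2)

theorem measurable_sinhGaussian (a : ℝ) : Measurable (sinhGaussian a) := by
  unfold sinhGaussian; fun_prop

/-- The two integrals are exchanged by the reflection `s ↦ -s - 2 log a`. -/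
theorem lintegral_sinhGaussian_symm {a : ℝ} (ha : 0 < a) :
    ∫⁻ s, ENNReal.ofReal (a * Real.exp (s / 2) * sinhGaussian a s) =
      ∫⁻ s, ENNReal.ofReal (Real.exp (-s / 2) * sinhGaussian a s) := by
  rw [← lintegral_neg_eq_self (fun s => ENNReal.ofReal (a * Real.exp (s / 2) * sinhGaussian a s)),
    ← lintegral_add_right_eq_self _ (2 * Real.log a)]
  refine lintegral_congr fun s => ?_
  have h1 : Real.exp (-(s + 2 * Real.log a) / 2) = Real.exp (-s / 2) * a⁻¹ := by
    rw [show -(s + 2 * Real.log a) / 2 = -s / 2 + -Real.log a by ring, Real.exp_add, Real.exp_neg,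
      Real.exp_log ha]
  have h2 : Real.exp (- -(s + 2 * Real.log a) / 2) = Real.exp (s / 2) * a := by
    rw [show - -(s + 2 * Real.log a) / 2 = s / 2 + Real.log a by ring, Real.exp_add,
      Real.exp_log ha]
  unfold sinhGaussian
  rw [h1, h2]
  congr 2
  · field_simp
  · congr 1
    field_simp
    ring

theorem lintegral_gaussian_half :
    ∫⁻ y : ℝ, ENNReal.ofReal (Real.exp (-(1 / 2) * y ^ 2)) = ENNReal.ofReal √(2 * Real.pi) := by
  rw [← ofReal_integral_eq_lintegral_ofReal (integrable_exp_neg_mul_sq (by norm_num))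
    (Filter.Eventually.of_forall fun _ => (Real.exp_pos _).le), integral_gaussian]
  congr 2
  ring

/-- The substitution `y = a e^{s/2} - e^{-s/2}` turns the Gaussian integral into the mean of this
integral and of that of `a e^{s/2}` times the same Gaussian, which equals it. -/
theorem lintegral_exp_mul_sinhGaussian {a : ℝ} (ha : 0 < a) :
    ∫⁻ s, ENNReal.ofReal (Real.exp (-s / 2) * sinhGaussian a s) =
      ENNReal.ofReal √(2 * Real.pi) := by
  set φ : ℝ → ℝ := fun s => a * Real.exp (s / 2) - Real.exp (-s / 2) with hφ
  set φ' : ℝ → ℝ := fun s => (a * Real.exp (s / 2) + Real.exp (-s / 2)) / 2 with hφ'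
  have hpos : ∀ s, 0 < φ' s := fun s => by positivity
  have hder : ∀ s, HasDerivAt φ (φ' s) s := by
    intro s
    have h1 : HasDerivAt (fun s : ℝ => s / 2) (1 / 2) s := (hasDerivAt_id s).div_const 2
    have h2 : HasDerivAt (fun s : ℝ => -s / 2) (-1 / 2) s := (hasDerivAt_id s).neg.div_const 2
    exact ((h1.exp.const_mul a).sub h2.exp).congr_deriv (by simp only [hφ']; ring)
  have hmono : StrictMono φ := strictMono_of_deriv_pos fun s => by rw [(hder s).deriv]; exact hpos s
  have hcont : Continuous φ := continuous_iff_continuousAt.2 fun s => (hder s).continuousAt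
  have e1 : Filter.Tendsto (fun s : ℝ => Real.exp (s / 2)) Filter.atTop Filter.atTop :=
    Real.tendsto_exp_atTop.comp (Filter.tendsto_id.atTop_div_const (by norm_num))
  have e2 : Filter.Tendsto (fun s : ℝ => -Real.exp (-s / 2)) Filter.atBot Filter.atBot :=
    Filter.tendsto_neg_atTop_atBot.comp (Real.tendsto_exp_atTop.comp
      (Filter.tendsto_neg_atBot_atTop.atTop_div_const (by norm_num)))
  have hsurj : Function.Surjective φ := by
    apply hcont.surjective
    · refine Filter.tendsto_atTop_mono' _ (f₁ := fun s => a * Real.exp (s / 2) - 1) ?_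
        (Filter.tendsto_atTop_add_const_right _ (-1) (e1.const_mul_atTop ha))
      filter_upwards [Filter.eventually_ge_atTop 0] with s hs
      have : Real.exp (-s / 2) ≤ 1 := Real.exp_le_one_iff.2 (by linarith)
      simp only [hφ]; linarith
    · refine Filter.tendsto_atBot_mono' _ (f₁ := fun s => -Real.exp (-s / 2) + a) ?_
        (Filter.tendsto_atBot_add_const_right _ a e2)
      filter_upwards [Filter.eventually_le_atBot 0] with s hs
      have : Real.exp (s / 2) ≤ 1 := Real.exp_le_one_iff.2 (by linarith)
      simp only [hφ]; nlinarith
  have hcv := lintegral_image_eq_lintegral_abs_deriv_mul MeasurableSet.univ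
    (fun s _ => (hder s).hasDerivWithinAt) hmono.injective.injOn
    (fun y => ENNReal.ofReal (Real.exp (-(1 / 2) * y ^ 2)))
  rw [Set.image_univ, hsurj.range_eq, setLIntegral_univ, setLIntegral_univ,
    lintegral_gaussian_half] at hcv
  have hsum : ∫⁻ s, ENNReal.ofReal |φ' s| * ENNReal.ofReal (Real.exp (-(1 / 2) * φ s ^ 2)) =
      (2⁻¹ : ENNReal) * (∫⁻ s, ENNReal.ofReal (a * Real.exp (s / 2) * sinhGaussian a s) +
        ENNReal.ofReal (Real.exp (-s / 2) * sinhGaussian a s)) := by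
    rw [← lintegral_const_mul' _ _ (by norm_num)]
    refine lintegral_congr fun s => ?_
    have h0 : 0 ≤ sinhGaussian a s := (Real.exp_pos _).le
    have h2 : (2⁻¹ : ENNReal) = ENNReal.ofReal (2⁻¹) := by
      rw [ENNReal.ofReal_inv_of_pos (by norm_num)]; norm_num
    rw [← ENNReal.ofReal_mul (abs_nonneg _), ← ENNReal.ofReal_add (by positivity) (by positivity),
      h2, ← ENNReal.ofReal_mul (by norm_num), abs_of_pos (hpos s)]
    congr 1
    simp only [hφ', hφ, sinhGaussian]
    ring
  have hm := measurable_sinhGaussian a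
  rw [hsum, lintegral_add_left (by fun_prop), lintegral_sinhGaussian_symm ha, ← two_mul,
    ← mul_assoc, ENNReal.inv_mul_cancel (by norm_num) (by norm_num), one_mul] at hcv
  exact hcv.symm

/-! ### Elimination of one vertex -/

/-- The Schur complement of a nonzero top left entry. -/
theorem det_succ_schur {n : ℕ} (M : Matrix (Fin (n + 1)) (Fin (n + 1)) ℝ) {ν : ℝ} (hν : ν ≠ 0)
    (h : M 0 0 = ν) :
    M.det = ν * (Matrix.of fun i j : Fin n =>
      M i.succ j.succ - M i.succ 0 * M 0 j.succ / ν).det := by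
  set B : Matrix (Fin (n + 1)) (Fin (n + 1)) ℝ := Matrix.of fun i j =>
    M i j - (if i = 0 then 0 else M i 0 / ν) * M 0 j with hB
  have h1 : M.det = B.det := by
    refine Matrix.det_eq_of_forall_row_eq_smul_add_const
      (fun i => if i = 0 then 0 else M i 0 / ν) 0 (by simp) fun i j => ?_
    simp [hB]
  rw [h1, Matrix.det_succ_column_zero, Fin.sum_univ_succ]
  have h0 : ∀ i : Fin n, B i.succ 0 = 0 := fun i => by simp [hB, h, hν]
  simp only [h0, mul_zero, zero_mul, Finset.sum_const_zero, add_zero]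
  have h00 : B 0 0 = ν := by simp [hB, h]
  rw [h00]
  simp only [Fin.val_zero, pow_zero, one_mul]
  congr 2
  ext i j
  simp [hB, Matrix.submatrix]
  ring

section Field

variable {U : Type*} [Fintype U]

/-- The field `u_i = ∑_k w_{ik} e^{t_k - t_i}` of a weighted graph with vertex set `U ∪ {o}`, where
`η i` is the weight of the edge between `i` and `o`, and `t` is pinned to `0` at `o`. -/
noncomputable def pinnedField (w : U → U → ℝ) (η t : U → ℝ) (i : U) : ℝ :=
  ∑ k, w i k * Real.exp (t k - t i) + η i * Real.exp (-t i)

/-- The density of the `t`-field of the `H^{2|2}` model, pinned at a ghost vertex joined to the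
vertices of `U` with weights `η`, up to the factor `(2π)^{|U|/2}`. -/
noncomputable def pinnedDensity [DecidableEq U] (w : U → U → ℝ) (η t : U → ℝ) : ℝ :=
  Real.exp (-(1 / 2) * (∑ i, pinnedField w η t i + ∑ i, η i * Real.exp (t i)
    - ∑ i, ∑ k, w i k - 2 * ∑ i, η i)) *
    √(Matrix.diagonal (pinnedField w η t) - Matrix.of w).det

/-- Every vertex of `U` is joined to the ghost vertex by a path of edges of positive weight. -/
def PinnedConnected (w : U → U → ℝ) (η : U → ℝ) : Prop :=
  ∀ S : Finset U, S.Nonempty → ∃ i ∈ S, 0 < η i ∨ ∃ k ∉ S, 0 < w i k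

theorem continuous_pinnedField (w : U → U → ℝ) (η : U → ℝ) :
    Continuous fun t => pinnedField w η t := by unfold pinnedField; fun_prop

theorem continuous_pinnedDensity [DecidableEq U] (w : U → U → ℝ) (η : U → ℝ) :
    Continuous (pinnedDensity w η) := by
  have := continuous_pinnedField w η
  have h : Continuous fun t => (Matrix.diagonal (pinnedField w η t) - Matrix.of w).det :=
    (this.matrix_diagonal.sub continuous_const).matrix_det
  unfold pinnedDensity
  refine Continuous.mul ?_ h.sqrt
  have : ∀ i, Continuous fun t => pinnedField w η t i := fun i => (continuous_apply i).comp this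
  fun_prop

end Field

section Elimination

variable {n : ℕ} (w : Fin (n + 1) → Fin (n + 1) → ℝ) (η : Fin (n + 1) → ℝ) (ν : ℝ)

/-- The weights on the remaining vertices after the elimination of the vertex `0`. -/
noncomputable def elimWeight (i j : Fin n) : ℝ :=
  w i.succ j.succ + w 0 i.succ * w 0 j.succ / ν

/-- The weights of the edges to the ghost vertex after the elimination of the vertex `0`. -/
noncomputable def elimGhost (i : Fin n) : ℝ := η i.succ + w 0 i.succ * η 0 / ν

variable {w η ν}

/-- A path through the eliminated vertex is replaced by one of the new edges. -/
theorem PinnedConnected.elim (hw : ∀ i j, w i j = w j i) (hw0 : ∀ i j, 0 ≤ w i j)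
    (hη0 : ∀ i, 0 ≤ η i) (hν : 0 < ν) (hc : PinnedConnected w η) :
    PinnedConnected (elimWeight w ν) (elimGhost w η ν) := by
  have hW : ∀ i j : Fin n, w i.succ j.succ ≤ elimWeight w ν i j := fun i j => by
    have := mul_nonneg (hw0 0 i.succ) (hw0 0 j.succ)
    have := div_nonneg this hν.le
    unfold elimWeight; linarith
  have hE : ∀ i : Fin n, η i.succ ≤ elimGhost w η ν i := fun i => by
    have := div_nonneg (mul_nonneg (hw0 0 i.succ) (hη0 0)) hν.le
    unfold elimGhost; linarith
  intro S hS
  obtain ⟨i, hi, h⟩ := hc (S.map (Fin.succEmb n)) (by simpa using hS)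
  obtain ⟨i, hiS, rfl⟩ := Finset.mem_map.1 hi
  simp only [Fin.coe_succEmb] at h
  rcases h with h | ⟨k, hk, h⟩
  · exact ⟨i, hiS, Or.inl (h.trans_le (hE i))⟩
  rcases Fin.eq_zero_or_eq_succ k with rfl | ⟨k, rfl⟩
  swap
  · exact ⟨i, hiS, Or.inr ⟨k, by simpa using hk, h.trans_le (hW i k)⟩⟩
  -- the edge leaves `S` through the eliminated vertex, so continue with `S ∪ {0}`
  have hi0 : 0 < w 0 i.succ := by rw [hw]; exact h
  obtain ⟨l, hl, h'⟩ := hc (insert 0 (S.map (Fin.succEmb n))) (by simp)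
  rcases Fin.eq_zero_or_eq_succ l with rfl | ⟨l, rfl⟩
  · rcases h' with h' | ⟨m, hm, h'⟩
    · refine ⟨i, hiS, Or.inl ?_⟩
      have := div_pos (mul_pos hi0 h') hν
      have := hη0 i.succ
      unfold elimGhost; linarith
    · rcases Fin.eq_zero_or_eq_succ m with rfl | ⟨m, rfl⟩
      · simp at hm
      · refine ⟨i, hiS, Or.inr ⟨m, by simpa using hm, ?_⟩⟩
        have := div_pos (mul_pos hi0 h') hν
        have := hw0 i.succ m.succ
        unfold elimWeight; linarith
  · have hlS : l ∈ S := by simpa using hl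
    rcases h' with h' | ⟨m, hm, h'⟩
    · exact ⟨l, hlS, Or.inl (h'.trans_le (hE l))⟩
    · rcases Fin.eq_zero_or_eq_succ m with rfl | ⟨m, rfl⟩
      · simp at hm
      · exact ⟨l, hlS, Or.inr ⟨m, by simpa using hm, h'.trans_le (hW l m)⟩⟩

variable (w η) in
/-- The total conductance `∑_k w_{0k} e^{t_k} + η_0` seen from the vertex `0`. -/
noncomputable def conductance (t : Fin n → ℝ) : ℝ :=
  ∑ k, w 0 (Fin.succ k) * Real.exp (t k) + η 0

theorem conductance_pos (hw0 : ∀ i j, 0 ≤ w i j) (hη0 : ∀ i, 0 ≤ η i)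
    (hc : PinnedConnected w η) (t : Fin n → ℝ) : 0 < conductance w η t := by
  have hsum : 0 ≤ ∑ k, w 0 (Fin.succ k) * Real.exp (t k) :=
    Finset.sum_nonneg fun k _ => mul_nonneg (hw0 _ _) (Real.exp_pos _).le
  obtain ⟨i, hi, h⟩ := hc {0} (by simp)
  obtain rfl : i = 0 := by simpa using hi
  rcases h with h | ⟨k, hk, h⟩
  · unfold conductance; linarith
  · rcases Fin.eq_zero_or_eq_succ k with rfl | ⟨k, rfl⟩
    · simp at hk
    · have : 0 < ∑ k, w 0 (Fin.succ k) * Real.exp (t k) :=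
        Finset.sum_pos' (fun k _ => mul_nonneg (hw0 _ _) (Real.exp_pos _).le)
          ⟨k, Finset.mem_univ _, mul_pos h (Real.exp_pos _)⟩
      have := hη0 0
      unfold conductance; linarith

variable {t : Fin n → ℝ} {x : ℝ}

/-- Here and below `ν` is the field at `0` without its loop. -/
theorem pinnedField_cons_zero (hν : Real.exp (-x) * conductance w η t = ν) :
    pinnedField w η (Fin.cons x t) 0 = w 0 0 + ν := by
  have h : ∑ k, w 0 (Fin.succ k) * Real.exp (t k - x) =
      Real.exp (-x) * ∑ k, w 0 (Fin.succ k) * Real.exp (t k) := by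
    rw [Finset.mul_sum]
    refine Finset.sum_congr rfl fun k _ => ?_
    rw [sub_eq_add_neg, Real.exp_add]; ring
  rw [← hν, conductance]
  simp only [pinnedField, Fin.sum_univ_succ, Fin.cons_zero, Fin.cons_succ, sub_self, Real.exp_zero,
    mul_one, h]
  ring

/-- Eliminating a vertex does not change the field at the other ones. -/
theorem pinnedField_cons_succ (hw : ∀ i j, w i j = w j i) (hν0 : ν ≠ 0)
    (hν : Real.exp (-x) * conductance w η t = ν) (i : Fin n) :
    pinnedField w η (Fin.cons x t) i.succ =
      pinnedField (elimWeight w ν) (elimGhost w η ν) t i := by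
  have hA : conductance w η t = ν * Real.exp x := by
    rw [← hν, Real.exp_neg]; field_simp
  have h2 : ∑ k, w 0 i.succ * w 0 (Fin.succ k) / ν * Real.exp (t k - t i) +
      w 0 i.succ * η 0 / ν * Real.exp (-t i) = w 0 i.succ * Real.exp (x - t i) := by
    have : w 0 i.succ * Real.exp (x - t i) =
        w 0 i.succ / ν * Real.exp (-t i) * conductance w η t := by
      rw [hA, sub_eq_add_neg, Real.exp_add]; field_simp
    rw [this, conductance, mul_add, Finset.mul_sum]
    congr 1
    · refine Finset.sum_congr rfl fun k _ => ?_
      rw [sub_eq_add_neg, Real.exp_add]; ring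
    · ring
  simp only [pinnedField, Fin.sum_univ_succ, Fin.cons_zero, Fin.cons_succ, elimWeight, elimGhost,
    add_mul, Finset.sum_add_distrib]
  rw [hw i.succ 0, ← h2]
  ring

theorem det_cons (hw : ∀ i j, w i j = w j i) (hν0 : ν ≠ 0)
    (hν : Real.exp (-x) * conductance w η t = ν) :
    (Matrix.diagonal (pinnedField w η (Fin.cons x t)) - Matrix.of w).det =
      ν * (Matrix.diagonal (pinnedField (elimWeight w ν) (elimGhost w η ν) t) -
        Matrix.of (elimWeight w ν)).det := by
  rw [det_succ_schur _ hν0 (by simp [pinnedField_cons_zero hν])]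
  congr 2
  ext i j
  have h1 : Matrix.diagonal (pinnedField w η (Fin.cons x t)) i.succ j.succ =
      Matrix.diagonal (pinnedField (elimWeight w ν) (elimGhost w η ν) t) i j := by
    rcases eq_or_ne i j with rfl | hij
    · simp [pinnedField_cons_succ hw hν0 hν]
    · rw [Matrix.diagonal_apply_ne _ hij, Matrix.diagonal_apply_ne]
      simpa using hij
  have h2 : Matrix.diagonal (pinnedField w η (Fin.cons x t)) i.succ 0 = 0 :=
    Matrix.diagonal_apply_ne _ (Fin.succ_ne_zero i)
  have h3 : Matrix.diagonal (pinnedField w η (Fin.cons x t)) 0 j.succ = 0 :=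
    Matrix.diagonal_apply_ne _ (Fin.succ_ne_zero j).symm
  simp only [Matrix.of_apply, Matrix.sub_apply, h1, h2, h3, elimWeight, hw i.succ 0]
  ring

theorem sum_mul_exp_cons (hν0 : ν ≠ 0) (hν : Real.exp (-x) * conductance w η t = ν)
    (c : Fin (n + 1) → ℝ) :
    ∑ i, c i * Real.exp ((Fin.cons x t : Fin (n + 1) → ℝ) i) =
      c 0 * η 0 / ν + ∑ i, (c i.succ + c 0 * w 0 i.succ / ν) * Real.exp (t i) := by
  have hA : Real.exp x = conductance w η t / ν := by
    rw [← hν, Real.exp_neg]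
    have : conductance w η t ≠ 0 := fun h => hν0 (by rw [← hν, h, mul_zero])
    field_simp
  simp only [Fin.sum_univ_succ, Fin.cons_zero, Fin.cons_succ, hA, conductance, add_mul,
    Finset.sum_add_distrib]
  have : ∑ i, c 0 * w 0 (Fin.succ i) / ν * Real.exp (t i) =
      c 0 / ν * ∑ i, w 0 (Fin.succ i) * Real.exp (t i) := by
    rw [Finset.mul_sum]; exact Finset.sum_congr rfl fun _ _ => by ring
  rw [this]
  ring

/-- Given `ν`, the density factors into a function of `ν` and the density of the model in which the
vertex `0` is eliminated. -/
theorem pinnedDensity_cons (hw : ∀ i j, w i j = w j i) (hν0 : 0 < ν)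
    (hν : Real.exp (-x) * conductance w η t = ν) {a : ℝ} (ha : a = η 0 + ∑ k, w 0 (Fin.succ k)) :
    pinnedDensity w η (Fin.cons x t) =
      √ν * Real.exp (-(1 / 2) * (ν + a ^ 2 / ν) + a) *
        pinnedDensity (elimWeight w ν) (elimGhost w η ν) t := by
  unfold pinnedDensity
  rw [det_cons hw hν0.ne' hν, Real.sqrt_mul hν0.le]
  set B := √(Matrix.diagonal (pinnedField (elimWeight w ν) (elimGhost w η ν) t) -
        Matrix.of (elimWeight w ν)).det
  have key : ∀ X P Q : ℝ, X = P + Q →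
      Real.exp X * (√ν * B) = √ν * Real.exp P * (Real.exp Q * B) := fun X P Q h => by
    rw [h, Real.exp_add]; ring
  apply key
  rw [sum_mul_exp_cons hν0.ne' hν η]
  set b := ∑ k, w 0 (Fin.succ k) with hb
  have e1 : ∑ i, elimGhost w η ν i = ∑ i : Fin n, η i.succ + b * η 0 / ν := by
    simp only [elimGhost, Finset.sum_add_distrib, ← Finset.sum_div, ← Finset.sum_mul, hb]
  have e2 : ∑ i, ∑ j, elimWeight w ν i j =
      ∑ i : Fin n, ∑ j : Fin n, w i.succ j.succ + b * b / ν := by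
    simp only [elimWeight, Finset.sum_add_distrib, ← Finset.sum_div, ← Finset.mul_sum,
      ← Finset.sum_mul, hb]
  have e3 : ∑ i : Fin n, (η i.succ + η 0 * w 0 i.succ / ν) * Real.exp (t i) =
      ∑ i, elimGhost w η ν i * Real.exp (t i) :=
    Finset.sum_congr rfl fun i _ => by rw [elimGhost, mul_comm (η 0)]
  rw [e1, e2, e3, Fin.sum_univ_succ, pinnedField_cons_zero hν,
    Finset.sum_congr rfl fun i _ => pinnedField_cons_succ hw hν0.ne' hν i,
    Fin.sum_univ_succ (fun i => ∑ k, w i k), Fin.sum_univ_succ η]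
  simp only [Fin.sum_univ_succ (w _), Finset.sum_add_distrib, hw (Fin.succ _) 0, ← hb]
  rw [ha]
  field_simp
  ring

end Elimination

/-! ### The total mass of the `H^{2|2}` model -/

theorem lintegral_fin_cons {n : ℕ} {f : (Fin (n + 1) → ℝ) → ENNReal} (hf : Measurable f) :
    ∫⁻ t, f t = ∫⁻ t : Fin n → ℝ, ∫⁻ x : ℝ, f (Fin.cons x t) := by
  have h := (volume_preserving_piFinSuccAbove (fun _ : Fin (n + 1) => ℝ) 0).symm
  rw [← h.lintegral_comp hf, Measure.volume_eq_prod, lintegral_prod_symm]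
  · simp [MeasurableEquiv.piFinSuccAbove, Fin.insertNthEquiv]
  · exact (hf.comp (MeasurableEquiv.measurable _)).aemeasurable

theorem continuous_fin_cons {n : ℕ} {X : Type*} [TopologicalSpace X] {f : X → ℝ}
    {g : X → Fin n → ℝ} (hf : Continuous f) (hg : Continuous g) :
    Continuous fun x => (Fin.cons (f x) (g x) : Fin (n + 1) → ℝ) :=
  continuous_pi fun i => by
    rcases Fin.eq_zero_or_eq_succ i with rfl | ⟨i, rfl⟩
    · simpa using hf
    · simp only [Fin.cons_succ]
      exact (continuous_apply i).comp hg

/-- The integral of `√ν e^{-(ν + a²/ν)/2 + a} (C + D a / ν)` over `ν = e^{-s}`. -/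
theorem lintegral_elim_factor {a : ℝ} (ha : 0 < a) {C D : ℝ} (hC : 0 ≤ C) (hD : 0 ≤ D) :
    ∫⁻ s : ℝ, ENNReal.ofReal (√(Real.exp (-s)) *
        Real.exp (-(1 / 2) * (Real.exp (-s) + a ^ 2 / Real.exp (-s)) + a) *
        (C + D * a / Real.exp (-s))) = ENNReal.ofReal (√(2 * Real.pi) * (C + D)) := by
  have hm := measurable_sinhGaussian a
  have h : ∀ s : ℝ, ENNReal.ofReal (√(Real.exp (-s)) *
        Real.exp (-(1 / 2) * (Real.exp (-s) + a ^ 2 / Real.exp (-s)) + a) *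
        (C + D * a / Real.exp (-s))) =
      ENNReal.ofReal C * ENNReal.ofReal (Real.exp (-s / 2) * sinhGaussian a s) +
      ENNReal.ofReal D * ENNReal.ofReal (a * Real.exp (s / 2) * sinhGaussian a s) := by
    intro s
    have h0 : 0 ≤ sinhGaussian a s := (Real.exp_pos _).le
    rw [← ENNReal.ofReal_mul hC, ← ENNReal.ofReal_mul hD, ← ENNReal.ofReal_add (by positivity)
      (by positivity)]
    congr 1
    have e1 : Real.exp (-s) = Real.exp (-s / 2) ^ 2 := by
      rw [← Real.exp_nat_mul]; congr 1; push_cast; ring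
    have e2 : Real.exp (s / 2) = (Real.exp (-s / 2))⁻¹ := by
      rw [← Real.exp_neg]; congr 1; ring
    unfold sinhGaussian
    rw [e1, e2, Real.sqrt_sq (Real.exp_pos _).le]
    set y := Real.exp (-s / 2)
    have hy : y ≠ 0 := (Real.exp_pos _).ne'
    have e3 : -(1 / 2) * (y ^ 2 + a ^ 2 / y ^ 2) + a = -(1 / 2) * (a * y⁻¹ - y) ^ 2 := by
      field_simp; ring
    rw [e3]
    field_simp
  rw [lintegral_congr h, lintegral_add_left (by fun_prop), lintegral_const_mul _ (by fun_prop),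
    lintegral_const_mul _ (by fun_prop), lintegral_sinhGaussian_symm ha,
    lintegral_exp_mul_sinhGaussian ha, ← add_mul, ← ENNReal.ofReal_add hC hD,
    ← ENNReal.ofReal_mul (by positivity), mul_comm]

/-- Induction on the number of vertices: with the other coordinates fixed, the coordinate of the
vertex `0` is translated by the logarithm of its conductance, after which it is independent of them,
and the others form the model on the graph with the vertex `0` eliminated. -/
theorem lintegral_pinnedDensity_fin (n : ℕ) : ∀ (w : Fin n → Fin n → ℝ) (η : Fin n → ℝ) (c₀ : ℝ)
    (c : Fin n → ℝ), (∀ i j, w i j = w j i) → (∀ i j, 0 ≤ w i j) → (∀ i, 0 ≤ η i) →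
    PinnedConnected w η → 0 ≤ c₀ → (∀ i, 0 ≤ c i) →
    ∫⁻ t, ENNReal.ofReal ((c₀ + ∑ i, c i * Real.exp (t i)) * pinnedDensity w η t) =
      ENNReal.ofReal (√(2 * Real.pi) ^ n * (c₀ + ∑ i, c i)) := by
  induction n with
  | zero =>
    intro w η c₀ c _ _ _ _ _ _
    have hv : (volume : Measure (Fin 0 → ℝ)) = Measure.dirac (fun i => i.elim0) := by
      rw [volume_pi]; exact Measure.pi_of_empty _ _
    rw [hv, lintegral_dirac]
    simp [pinnedDensity]
  | succ n ih =>
    intro w η c₀ c hw hw0 hη0 hc hc₀ hc0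
    set a := η 0 + ∑ k, w 0 (Fin.succ k) with ha
    have ha0 : 0 < a := by
      have := conductance_pos hw0 hη0 hc 0
      simpa [conductance, add_comm] using this
    have hA := conductance_pos hw0 hη0 hc
    have hAc : Continuous (conductance w η) := by unfold conductance; fun_prop
    set f : (Fin (n + 1) → ℝ) → ENNReal := fun t =>
      ENNReal.ofReal ((c₀ + ∑ i, c i * Real.exp (t i)) * pinnedDensity w η t) with hf
    have hfc : Continuous f := by
      have := continuous_pinnedDensity w η
      exact ENNReal.continuous_ofReal.comp (by fun_prop)
    have hlog : Continuous fun t : Fin n → ℝ => Real.log (conductance w η t) :=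
      hAc.log fun t => (hA t).ne'
    -- translate by the logarithm of the conductance, so that `ν = e^{-s}` is independent of `t`
    have hshift : ∀ t : Fin n → ℝ, ∫⁻ x, f (Fin.cons x t) =
        ∫⁻ s, f (Fin.cons (s + Real.log (conductance w η t)) t) := fun t =>
      (lintegral_add_right_eq_self (fun x => f (Fin.cons x t)) _).symm
    rw [lintegral_fin_cons hfc.measurable, lintegral_congr hshift, lintegral_lintegral_swap]
    swap
    · refine (hfc.comp (continuous_fin_cons ?_ continuous_fst)).measurable.aemeasurable
      exact continuous_snd.add (hlog.comp continuous_fst)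
    have hinner : ∀ s : ℝ,
        ∫⁻ t : Fin n → ℝ, f (Fin.cons (s + Real.log (conductance w η t)) t) =
        ENNReal.ofReal (√(2 * Real.pi) ^ n) * ENNReal.ofReal (√(Real.exp (-s)) *
          Real.exp (-(1 / 2) * (Real.exp (-s) + a ^ 2 / Real.exp (-s)) + a) *
          ((c₀ + ∑ i : Fin n, c i.succ) + c 0 * a / Real.exp (-s))) := by
      intro s
      set ν := Real.exp (-s) with hνdef
      have hν0 : 0 < ν := Real.exp_pos _
      have hν : ∀ t, Real.exp (-(s + Real.log (conductance w η t))) * conductance w η t = ν := by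
        intro t
        rw [neg_add, Real.exp_add, Real.exp_neg (Real.log _), Real.exp_log (hA t), mul_assoc,
          inv_mul_cancel₀ (hA t).ne', mul_one]
      have hfs : ∀ t : Fin n → ℝ, f (Fin.cons (s + Real.log (conductance w η t)) t) =
          ENNReal.ofReal (√ν * Real.exp (-(1 / 2) * (ν + a ^ 2 / ν) + a)) *
          ENNReal.ofReal (((c₀ + c 0 * η 0 / ν) +
            ∑ i, (c i.succ + c 0 * w 0 i.succ / ν) * Real.exp (t i)) *
            pinnedDensity (elimWeight w ν) (elimGhost w η ν) t) := by
        intro t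
        rw [← ENNReal.ofReal_mul (by positivity), hf]
        simp only
        rw [sum_mul_exp_cons hν0.ne' (hν t), pinnedDensity_cons hw hν0 (hν t) ha]
        congr 1
        ring
      rw [lintegral_congr hfs, lintegral_const_mul' _ _ ENNReal.ofReal_ne_top, ih]
      · rw [← ENNReal.ofReal_mul (by positivity), ← ENNReal.ofReal_mul (by positivity)]
        congr 1
        rw [Finset.sum_add_distrib, ← Finset.sum_div, ← Finset.mul_sum, ha]
        ring
      · intro i j; simp only [elimWeight, hw i.succ, mul_comm]
      · intro i j
        have := hw0 i.succ j.succ; have := hw0 0 i.succ; have := hw0 0 j.succ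
        unfold elimWeight; positivity
      · intro i
        have := hη0 i.succ; have := hη0 0; have := hw0 0 i.succ
        unfold elimGhost; positivity
      · exact hc.elim hw hw0 hη0 hν0
      · have := hη0 0; have := hc0 0; positivity
      · intro i; have := hc0 i.succ; have := hc0 0; have := hw0 0 i.succ; positivity
    rw [lintegral_congr hinner, lintegral_const_mul' _ _ ENNReal.ofReal_ne_top,
      lintegral_elim_factor ha0 (add_nonneg hc₀ (Finset.sum_nonneg fun i _ => hc0 _)) (hc0 0),
      ← ENNReal.ofReal_mul (by positivity), Fin.sum_univ_succ]
    congr 1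
    ring

theorem lintegral_pinnedDensity {U : Type*} [Fintype U] [DecidableEq U] {w : U → U → ℝ}
    {η : U → ℝ} {c₀ : ℝ} {c : U → ℝ} (hw : ∀ i j, w i j = w j i) (hw0 : ∀ i j, 0 ≤ w i j)
    (hη0 : ∀ i, 0 ≤ η i) (hc : PinnedConnected w η) (hc₀ : 0 ≤ c₀) (hc0 : ∀ i, 0 ≤ c i) :
    ∫⁻ t, ENNReal.ofReal ((c₀ + ∑ i, c i * Real.exp (t i)) * pinnedDensity w η t) =
      ENNReal.ofReal (√(2 * Real.pi) ^ Fintype.card U * (c₀ + ∑ i, c i)) := by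
  let e : Fin (Fintype.card U) ≃ U := (Fintype.equivFin U).symm
  have hconn : PinnedConnected (fun i j => w (e i) (e j)) (fun i => η (e i)) := by
    intro S hS
    obtain ⟨i, hi, h⟩ := hc (S.map e.toEmbedding) (by simpa using hS)
    obtain ⟨i, hiS, rfl⟩ := Finset.mem_map.1 hi
    refine ⟨i, hiS, ?_⟩
    rcases h with h | ⟨k, hk, h⟩
    · exact Or.inl h
    · obtain ⟨k, rfl⟩ := e.surjective k
      exact Or.inr ⟨k, by simpa using hk, h⟩
  have key := lintegral_pinnedDensity_fin _ (fun i j => w (e i) (e j)) (fun i => η (e i)) c₀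
    (fun i => c (e i)) (fun i j => hw _ _) (fun i j => hw0 _ _) (fun i => hη0 _) hconn hc₀
    (fun i => hc0 _)
  rw [e.sum_comp c] at key
  rw [← key, ← (volume_measurePreserving_piCongrLeft (fun _ : U => ℝ) e).lintegral_comp]
  swap
  · have := continuous_pinnedDensity w η
    exact (ENNReal.continuous_ofReal.comp (by fun_prop)).measurable
  refine lintegral_congr fun t => ?_
  have ht : ∀ i, MeasurableEquiv.piCongrLeft (fun _ : U => ℝ) e t (e i) = t i := fun i =>
    Equiv.piCongrLeft_apply_apply (fun _ : U => ℝ) e t i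
  set T := MeasurableEquiv.piCongrLeft (fun _ : U => ℝ) e t
  have hfield : ∀ i, pinnedField w η T (e i) =
      pinnedField (fun i j => w (e i) (e j)) (fun i => η (e i)) t i := by
    intro i
    simp only [pinnedField, ← ht, e.sum_comp fun k => w (e i) k * Real.exp (T k - T (e i))]
  have hdet : (Matrix.diagonal (pinnedField w η T) - Matrix.of w).det =
      (Matrix.diagonal (pinnedField (fun i j => w (e i) (e j)) (fun i => η (e i)) t) -
        Matrix.of fun i j => w (e i) (e j)).det := by
    rw [← Matrix.det_submatrix_equiv_self e]
    congr 1
    ext i j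
    simp [Matrix.diagonal_apply, hfield]
  congr 1
  unfold pinnedDensity
  rw [hdet, ← e.sum_comp (pinnedField w η T), ← e.sum_comp fun i => η i * Real.exp (T i),
    ← e.sum_comp η, ← e.sum_comp fun i => c i * Real.exp (T i), ← e.sum_comp fun i => ∑ k, w i k]
  simp only [hfield, ht]
  simp only [fun i => e.sum_comp (w (e i))]

/-! ### Matching polynomials -/

section MatchPoly

variable {V : Type*} [DecidableEq V]

/-- The sum over the matchings `M` of `S` of `∏_{ij ∈ M} (-w i j) * ∏_{i ∉ M} x i`, computed by
deciding whether some vertex of `S` is left unmatched or matched to another one. The result does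
not depend on the choice of that vertex, see `matchPoly_eq`. -/
noncomputable def matchPoly (w : V → V → ℝ) (x : V → ℝ) (S : Finset V) : ℝ :=
  if h : S.Nonempty then
    x h.choose * matchPoly w x (S.erase h.choose) -
      ∑ i ∈ S.erase h.choose, w i h.choose * matchPoly w x ((S.erase h.choose).erase i)
  else 1
termination_by S.card
decreasing_by
  · exact Finset.card_erase_lt_of_mem h.choose_spec
  · exact (Finset.card_erase_le).trans_lt (Finset.card_erase_lt_of_mem h.choose_spec)

@[simp]
theorem matchPoly_empty (w : V → V → ℝ) (x : V → ℝ) : matchPoly w x ∅ = 1 := by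
  rw [matchPoly]; simp

theorem exists_matchPoly_eq {S : Finset V} (h : S.Nonempty) : ∃ j ∈ S, ∀ (w : V → V → ℝ)
    (x : V → ℝ), matchPoly w x S = x j * matchPoly w x (S.erase j) -
      ∑ i ∈ S.erase j, w i j * matchPoly w x ((S.erase j).erase i) :=
  ⟨h.choose, h.choose_spec, fun w x => by rw [matchPoly, dif_pos h]⟩

theorem sum_sum_erase_comm {M : Type*} [AddCommMonoid M] (R : Finset V) (f : V → V → M) :
    ∑ i ∈ R, ∑ l ∈ R.erase i, f i l = ∑ i ∈ R, ∑ l ∈ R.erase i, f l i :=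
  Finset.sum_comm' fun x y => by simp only [Finset.mem_erase]; tauto

/-- The defining recursion holds for every vertex `j`. -/
theorem matchPoly_eq {w : V → V → ℝ} (hw : ∀ i j, w i j = w j i) (x : V → ℝ) {S : Finset V} {j : V}
    (hj : j ∈ S) : matchPoly w x S = x j * matchPoly w x (S.erase j) -
      ∑ i ∈ S.erase j, w i j * matchPoly w x ((S.erase j).erase i) := by
  induction S using Finset.strongInduction generalizing j with
  | H S ih =>
    obtain ⟨k, hk, h⟩ := exists_matchPoly_eq ⟨j, hj⟩
    rcases eq_or_ne k j with rfl | hkj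
    · exact h w x
    set R := (S.erase k).erase j with hR
    have hR' : (S.erase j).erase k = R := Finset.erase_right_comm
    have hjk : j ∈ S.erase k := Finset.mem_erase.2 ⟨hkj.symm, hj⟩
    have hkj' : k ∈ S.erase j := Finset.mem_erase.2 ⟨hkj, hk⟩
    have expand : ∀ {a b : V}, b ∈ S → a ∈ S.erase b → (S.erase b).erase a = R →
        ∑ i ∈ S.erase b, w i b * matchPoly w x ((S.erase b).erase i) =
          w a b * matchPoly w x R + (x a * ∑ i ∈ R, w i b * matchPoly w x (R.erase i) -
            ∑ i ∈ R, ∑ l ∈ R.erase i, w i b * (w l a * matchPoly w x ((R.erase i).erase l))) := by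
      intro a b hb ha hab
      rw [← Finset.add_sum_erase _ _ ha, hab, Finset.mul_sum, ← Finset.sum_sub_distrib]
      congr 1
      refine Finset.sum_congr rfl fun i hi => ?_
      rw [← hab, Finset.mem_erase] at hi
      rw [ih _ ((Finset.erase_subset _ _).trans_ssubset (Finset.erase_ssubset hb))
        (Finset.mem_erase.2 ⟨hi.1.symm, ha⟩), Finset.erase_right_comm, hab, mul_sub,
        Finset.mul_sum]
      ring
    rw [h, expand hk hjk rfl, expand hj hkj' hR', ih _ (Finset.erase_ssubset hk) hjk,
      ih _ (Finset.erase_ssubset hj) hkj', hR', ← hR, hw k j, sum_sum_erase_comm]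
    have : ∀ i l, w l k * (w i j * matchPoly w x ((R.erase l).erase i)) =
        w i j * (w l k * matchPoly w x ((R.erase i).erase l)) := fun i l => by
      rw [Finset.erase_right_comm]; ring
    simp only [this]
    ring

theorem matchPoly_insert {w : V → V → ℝ} (hw : ∀ i j, w i j = w j i) (x : V → ℝ) {S : Finset V}
    {j : V} (hj : j ∉ S) : matchPoly w x (insert j S) = x j * matchPoly w x S -
      ∑ i ∈ S, w i j * matchPoly w x (S.erase i) := by
  rw [matchPoly_eq hw x (Finset.mem_insert_self j S), Finset.erase_insert hj]

theorem matchPoly_congr {w w' : V → V → ℝ} {x x' : V → ℝ} {S : Finset V}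
    (hw : ∀ i ∈ S, ∀ j ∈ S, w i j = w' i j) (hx : ∀ i ∈ S, x i = x' i) :
    matchPoly w x S = matchPoly w' x' S := by
  induction S using Finset.strongInduction with
  | H S ih =>
    rcases S.eq_empty_or_nonempty with rfl | hS
    · simp
    obtain ⟨j, hj, h⟩ := exists_matchPoly_eq hS
    have ih' : ∀ R ⊂ S, matchPoly w x R = matchPoly w' x' R := fun R hR =>
      ih R hR (fun i hi k hk => hw i (hR.1 hi) k (hR.1 hk)) fun i hi => hx i (hR.1 hi)
    rw [h, h, hx j hj, ih' _ (Finset.erase_ssubset hj)]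
    congr 1
    refine Finset.sum_congr rfl fun i hi => ?_
    rw [hw i (Finset.mem_of_mem_erase hi) j hj,
      ih' _ ((Finset.erase_subset _ _).trans_ssubset (Finset.erase_ssubset hj))]

theorem continuous_matchPoly {X : Type*} [TopologicalSpace X] {w : X → V → V → ℝ}
    {x : X → V → ℝ} (hw : ∀ i j, Continuous fun p => w p i j) (hx : ∀ i, Continuous fun p => x p i)
    (S : Finset V) : Continuous fun p => matchPoly (w p) (x p) S := by
  induction S using Finset.strongInduction with
  | H S ih =>
    rcases S.eq_empty_or_nonempty with rfl | hS
    · simpa using continuous_const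
    obtain ⟨j, hj, h⟩ := exists_matchPoly_eq hS
    simp only [h]
    refine ((hx j).mul (ih _ (Finset.erase_ssubset hj))).sub
      (continuous_finsetSum _ fun i hi => (hw i j).mul (ih _ ?_))
    exact (Finset.erase_subset _ _).trans_ssubset (Finset.erase_ssubset hj)

/-- The matching polynomial is affine in each variable `x j`. -/
theorem matchPoly_update_of_mem {w : V → V → ℝ} (hw : ∀ i j, w i j = w j i) {x x' : V → ℝ} {s : ℝ}
    {S : Finset V} {j : V} (hj : j ∈ S) (hxj : x' j = x j + s) (hx : ∀ i ∈ S, i ≠ j → x' i = x i) :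
    matchPoly w x' S = matchPoly w x S + s * matchPoly w x (S.erase j) := by
  have hc : ∀ R ⊆ S.erase j, matchPoly w x' R = matchPoly w x R := fun R hR =>
    matchPoly_congr (fun _ _ _ _ => rfl) fun i hi =>
      hx i (Finset.mem_of_mem_erase (hR hi)) (Finset.ne_of_mem_erase (hR hi))
  rw [matchPoly_eq hw x' hj, matchPoly_eq hw x hj, hxj, hc _ subset_rfl,
    Finset.sum_congr rfl fun i _ => by rw [hc _ (Finset.erase_subset i _)]]
  ring

/-- The derivative of the matching polynomial in the direction `y`. -/
theorem hasDerivAt_matchPoly {w : V → V → ℝ} (hw : ∀ i j, w i j = w j i) (x y : V → ℝ)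
    (S : Finset V) : HasDerivAt (fun s : ℝ => matchPoly w (fun i => x i + s * y i) S)
      (∑ i ∈ S, y i * matchPoly w x (S.erase i)) 0 := by
  induction S using Finset.strongInduction with
  | H S ih =>
    rcases S.eq_empty_or_nonempty with rfl | ⟨j, hj⟩
    · simpa using hasDerivAt_const (0 : ℝ) (1 : ℝ)
    have hlin : HasDerivAt (fun s : ℝ => x j + s * y j) (y j) 0 := by
      simpa using ((hasDerivAt_id (0 : ℝ)).mul_const (y j)).const_add (x j)
    have h := (hlin.mul (ih _ (Finset.erase_ssubset hj))).sub
      (HasDerivAt.fun_sum (u := S.erase j) fun i _ => (ih ((S.erase j).erase i)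
        ((Finset.erase_subset _ _).trans_ssubset (Finset.erase_ssubset hj))).const_mul (w i j))
    have hfun : (fun s : ℝ => matchPoly w (fun i => x i + s * y i) S) = _ :=
      funext fun s => matchPoly_eq hw (fun i => x i + s * y i) hj
    rw [hfun]
    refine h.congr_deriv ?_
    simp only [zero_mul, add_zero]
    rw [← Finset.add_sum_erase S _ hj, Finset.mul_sum, add_sub_assoc, ← Finset.sum_sub_distrib]
    simp only [Finset.mul_sum]
    congr 1
    rw [Finset.sum_sub_distrib, sum_sum_erase_comm, ← Finset.sum_sub_distrib]
    refine Finset.sum_congr rfl fun i hi => ?_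
    have hij : j ∈ S.erase i := Finset.mem_erase.2 ⟨(Finset.ne_of_mem_erase hi).symm, hj⟩
    rw [matchPoly_eq hw x hij, Finset.erase_right_comm, mul_sub, Finset.mul_sum]
    congr 1
    · ring
    · refine Finset.sum_congr rfl fun l _ => ?_
      rw [Finset.erase_right_comm, Finset.erase_right_comm (s := S)]
      ring

end MatchPoly

/-! ### The `t`-field on a weighted graph -/

section TField

variable {V : Type*} [Fintype V] [DecidableEq V]

/-- The field `u_i = ∑_k w_{ik} e^{T_k - T_i}`. -/
noncomputable def tField (w : V → V → ℝ) (T : V → ℝ) (i : V) : ℝ :=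
  ∑ k, w i k * Real.exp (T k - T i)

/-- The random Schrödinger operator `diag(u) - w`, which annihilates the vector `e^T`. -/
noncomputable def tMatrix (w : V → V → ℝ) (T : V → ℝ) : Matrix V V ℝ :=
  Matrix.diagonal (tField w T) - Matrix.of w

/-- The density of the `t`-field of the `H^{2|2}` model with weights `w` pinned at `o`, up to the
factor `(2π)^{(|V|-1)/2}`. -/
noncomputable def tDensity (w : V → V → ℝ) (o : V) (t : {k : V // k ≠ o} → ℝ) : ℝ :=
  Real.exp (-(1 / 2) * (∑ i, tField w (pin o t) i - ∑ i, ∑ k, w i k)) *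
    √(principalCofactor (tMatrix w (pin o t)) o)

/-- Every nontrivial cut is crossed by an edge of positive weight. -/
def WeightConnected (w : V → V → ℝ) : Prop :=
  ∀ S : Finset V, S.Nonempty → S ≠ Finset.univ → ∃ i ∈ S, ∃ k ∉ S, 0 < w i k

omit [Fintype V] in
@[simp]
theorem pin_self (o : V) (t : {k : V // k ≠ o} → ℝ) : pin o t o = 0 := by simp [pin]

omit [Fintype V] in
@[simp]
theorem pin_coe (o : V) (t : {k : V // k ≠ o} → ℝ) (k : {k : V // k ≠ o}) : pin o t k = t k := by
  simp [pin, k.2]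

omit [Fintype V] in
theorem continuous_pin (o : V) : Continuous (pin o : ({k : V // k ≠ o} → ℝ) → V → ℝ) := by
  refine continuous_pi fun i => ?_
  by_cases h : i = o
  · simpa [pin, h] using continuous_const
  · simp only [pin, h, dif_neg, not_false_eq_true]
    exact continuous_apply _

omit [DecidableEq V] in
theorem continuous_tField (w : V → V → ℝ) : Continuous (tField w) := by
  unfold tField; fun_prop

theorem continuous_tDensity (w : V → V → ℝ) (o : V) : Continuous (tDensity w o) := by
  have h1 : Continuous fun t => tField w (pin o t) := (continuous_tField w).comp (continuous_pin o)
  have h2 : Continuous fun t => principalCofactor (tMatrix w (pin o t)) o :=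
    ((h1.matrix_diagonal.sub continuous_const).matrix_submatrix _ _).matrix_det
  have h3 : ∀ i, Continuous fun t => tField w (pin o t) i := fun i => (continuous_apply i).comp h1
  unfold tDensity
  refine Continuous.mul ?_ h2.sqrt
  fun_prop

theorem tDensity_nonneg (w : V → V → ℝ) (o : V) (t : {k : V // k ≠ o} → ℝ) : 0 ≤ tDensity w o t := by
  unfold tDensity; positivity

omit [DecidableEq V] in
theorem tField_nonneg {w : V → V → ℝ} (hw0 : ∀ i j, 0 ≤ w i j) (T : V → ℝ) (i : V) :
    0 ≤ tField w T i :=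
  Finset.sum_nonneg fun k _ => mul_nonneg (hw0 i k) (Real.exp_pos _).le

theorem tField_pin_coe (w : V → V → ℝ) (o : V) (t : {k : V // k ≠ o} → ℝ) (i : {k : V // k ≠ o}) :
    tField w (pin o t) i = pinnedField (fun i j : {k : V // k ≠ o} => w i j) (fun i => w i o) t i := by
  rw [tField, pinnedField, Fintype.sum_eq_add_sum_subtype_ne _ o]
  simp [add_comm]

theorem tDensity_eq_pinnedDensity {w : V → V → ℝ} (hw : ∀ i j, w i j = w j i) (o : V)
    (t : {k : V // k ≠ o} → ℝ) :
    tDensity w o t = pinnedDensity (fun i j : {k : V // k ≠ o} => w i j) (fun i => w i o) t := by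
  unfold tDensity pinnedDensity
  congr 2
  · have h1 : tField w (pin o t) o = w o o + ∑ i : {k : V // k ≠ o}, w i o * Real.exp (t i) := by
      rw [tField, Fintype.sum_eq_add_sum_subtype_ne _ o]
      simp [hw o]
    simp only [Fintype.sum_eq_add_sum_subtype_ne _ o, h1, tField_pin_coe, Finset.sum_add_distrib,
      hw o]
    ring
  · unfold principalCofactor
    congr 1
    ext i j
    rw [Matrix.submatrix_apply, tMatrix, Matrix.sub_apply, Matrix.sub_apply]
    congr 1
    rcases eq_or_ne i j with rfl | h
    · rw [Matrix.diagonal_apply_eq, Matrix.diagonal_apply_eq, tField_pin_coe]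
    · rw [Matrix.diagonal_apply_ne _ h, Matrix.diagonal_apply_ne]
      simpa [Subtype.ext_iff] using h

omit [DecidableEq V] in
theorem WeightConnected.pinned {w : V → V → ℝ} (hc : WeightConnected w) (o : V) :
    PinnedConnected (fun i j : {k : V // k ≠ o} => w i j) (fun i => w i o) := by
  intro S hS
  obtain ⟨i, hi, k, hk, h⟩ := hc (S.map (Function.Embedding.subtype _)) (by simpa using hS)
    (fun h => by
      have : o ∈ S.map (Function.Embedding.subtype _) := h ▸ Finset.mem_univ o
      simp at this)
  obtain ⟨i, hiS, rfl⟩ := Finset.mem_map.1 hi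
  refine ⟨i, hiS, ?_⟩
  rcases eq_or_ne k o with rfl | hko
  · exact Or.inl h
  · refine Or.inr ⟨⟨k, hko⟩, fun hk' => hk ?_, h⟩
    exact Finset.mem_map.2 ⟨_, hk', rfl⟩

/-- The factor `(2π)^{(|V|-1)/2}`. -/
noncomputable def gaussConst (o : V) : ℝ := √(2 * Real.pi) ^ Fintype.card {k : V // k ≠ o}

theorem gaussConst_pos (o : V) : 0 < gaussConst o := by unfold gaussConst; positivity

/-- The function `e^{t_l}` has mean one for the `H^{2|2}` model, whatever the vertex `l`. -/
theorem integral_exp_mul_tDensity {w : V → V → ℝ} (hw : ∀ i j, w i j = w j i)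
    (hw0 : ∀ i j, 0 ≤ w i j) (hc : WeightConnected w) (o l : V) :
    Integrable (fun t => Real.exp (pin o t l) * tDensity w o t) ∧
      ∫ t, Real.exp (pin o t l) * tDensity w o t = gaussConst o := by
  have hnn : ∀ t, 0 ≤ Real.exp (pin o t l) * tDensity w o t := fun t =>
    mul_nonneg (Real.exp_pos _).le (tDensity_nonneg _ _ _)
  have hcont : Continuous fun t => Real.exp (pin o t l) * tDensity w o t :=
    (Real.continuous_exp.comp ((continuous_apply l).comp (continuous_pin o))).mul
      (continuous_tDensity w o)
  have key : ∫⁻ t, ENNReal.ofReal (Real.exp (pin o t l) * tDensity w o t) =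
      ENNReal.ofReal (gaussConst o) := by
    have h := lintegral_pinnedDensity (U := {k : V // k ≠ o}) (w := fun i j => w i j)
      (η := fun i => w i o) (c₀ := if l = o then 1 else 0) (c := fun i => if i.1 = l then 1 else 0)
      (fun i j => hw i j) (fun i j => hw0 i j) (fun i => hw0 i o) (hc.pinned o)
      (by split_ifs <;> norm_num) (fun i => by split_ifs <;> norm_num)
    simp only [← tDensity_eq_pinnedDensity hw] at h
    rcases eq_or_ne l o with rfl | hl
    · have h0 : ∀ i : {k : V // k ≠ l}, (if i.1 = l then (1 : ℝ) else 0) = 0 := fun i =>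
        if_neg i.2
      simpa [h0, gaussConst] using h
    · have h0 : ∀ i : {k : V // k ≠ o}, (i.1 = l) = (i = ⟨l, hl⟩) := fun i => by
        simp [Subtype.ext_iff]
      have h1 : ∀ t, pin o t l = t ⟨l, hl⟩ := fun t => pin_coe o t ⟨l, hl⟩
      simp only [h1]
      simpa [h0, hl, gaussConst] using h
  have hint : Integrable (fun t => Real.exp (pin o t l) * tDensity w o t) := by
    refine ⟨hcont.aestronglyMeasurable, ?_⟩
    rw [hasFiniteIntegral_iff_ofReal (Filter.Eventually.of_forall hnn), key]
    exact ENNReal.ofReal_lt_top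
  refine ⟨hint, ?_⟩
  have := ofReal_integral_eq_lintegral_ofReal hint (Filter.Eventually.of_forall hnn)
  rw [key] at this
  exact (ENNReal.ofReal_eq_ofReal_iff (integral_nonneg hnn) (gaussConst_pos o).le).1 this

/-! ### Moments of the field -/

/-- First moments from a Laplace transform known near `0`. -/
theorem integral_mul_of_laplace {α : Type*} [MeasurableSpace α] {μ : Measure α} {X g : α → ℝ}
    (hg : Measurable g) (hg0 : ∀ a, 0 ≤ g a) {Φ : ℝ → ℝ} {Φ' ε : ℝ} (hε : 0 < ε)
    (h : ∀ r : ℝ, |r| < ε → Integrable (fun a => Real.exp (r * X a) * g a) μ ∧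
      ∫ a, Real.exp (r * X a) * g a ∂μ = Φ r) (hΦ : HasDerivAt Φ Φ' 0) :
    Integrable (fun a => X a * g a) μ ∧ ∫ a, X a * g a ∂μ = Φ' := by
  set ρ : α → ENNReal := fun a => ENNReal.ofReal (g a) with hρ
  have hρm : Measurable ρ := hg.ennreal_ofReal
  have hfin : ∀ᵐ a ∂μ, ρ a < ⊤ := Filter.Eventually.of_forall fun a => ENNReal.ofReal_lt_top
  have hreal : ∀ a, (ρ a).toReal = g a := fun a => ENNReal.toReal_ofReal (hg0 a)
  have hI : ∀ f : α → ℝ, Integrable f (μ.withDensity ρ) ↔ Integrable (fun a => f a * g a) μ :=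
    fun f => by rw [integrable_withDensity_iff hρm hfin]; simp only [hreal]
  have hE : ∀ f : α → ℝ, ∫ a, f a ∂(μ.withDensity ρ) = ∫ a, f a * g a ∂μ := fun f => by
    rw [integral_withDensity_eq_integral_toReal_smul hρm hfin]
    simp only [hreal, smul_eq_mul, mul_comm]
  have hmem : (0 : ℝ) ∈ interior (ProbabilityTheory.integrableExpSet X (μ.withDensity ρ)) := by
    rw [mem_interior_iff_mem_nhds]
    filter_upwards [Metric.ball_mem_nhds (0 : ℝ) hε] with r hr
    rw [Metric.mem_ball, dist_zero_right, Real.norm_eq_abs] at hr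
    exact (hI _).2 (h r hr).1
  have hder := ProbabilityTheory.hasDerivAt_mgf hmem
  have hEq : ProbabilityTheory.mgf X (μ.withDensity ρ) =ᶠ[nhds 0] Φ := by
    filter_upwards [Metric.ball_mem_nhds (0 : ℝ) hε] with r hr
    rw [Metric.mem_ball, dist_zero_right, Real.norm_eq_abs] at hr
    rw [ProbabilityTheory.mgf, hE, (h r hr).2]
  refine ⟨(hI X).1 (ProbabilityTheory.integrable_of_mem_interior_integrableExpSet hmem), ?_⟩
  have := (hEq.hasDerivAt_iff.1 hder).unique hΦ
  simpa [hE] using this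

/-- The weights `s i * s k * w i k`, obtained from `w` by translating the `t`-field by `log s`. -/
def scaleWeight (s : V → ℝ) (w : V → V → ℝ) (i k : V) : ℝ := s i * s k * w i k

omit [DecidableEq V] in
theorem tField_scaleWeight (w : V → V → ℝ) {s : V → ℝ} (hs : ∀ i, 0 < s i) (T : V → ℝ) (i : V) :
    tField (scaleWeight s w) T i = s i ^ 2 * tField w (fun k => T k + Real.log (s k)) i := by
  simp only [tField, Finset.mul_sum]
  refine Finset.sum_congr rfl fun k _ => ?_
  rw [show T k + Real.log (s k) - (T i + Real.log (s i)) =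
    T k - T i + Real.log (s k) + -Real.log (s i) by ring, Real.exp_add, Real.exp_add, Real.exp_neg,
    Real.exp_log (hs k), Real.exp_log (hs i), scaleWeight]
  have := (hs i).ne'
  field_simp

theorem principalCofactor_tMatrix_scaleWeight (w : V → V → ℝ) {s : V → ℝ} (hs : ∀ i, 0 < s i)
    (T : V → ℝ) (o : V) :
    principalCofactor (tMatrix (scaleWeight s w) T) o = (∏ k : {k : V // k ≠ o}, s k) ^ 2 *
      principalCofactor (tMatrix w fun k => T k + Real.log (s k)) o := by
  have h : (tMatrix (scaleWeight s w) T).submatrix (fun k : {k : V // k ≠ o} => (k : V))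
      (fun k : {k : V // k ≠ o} => (k : V)) =
      Matrix.diagonal (fun k : {k : V // k ≠ o} => s k) *
        (tMatrix w fun k => T k + Real.log (s k)).submatrix (fun k : {k : V // k ≠ o} => (k : V))
          (fun k : {k : V // k ≠ o} => (k : V)) *
        Matrix.diagonal (fun k : {k : V // k ≠ o} => s k) := by
    ext i j
    rw [Matrix.mul_diagonal, Matrix.diagonal_mul]
    simp only [Matrix.submatrix_apply, tMatrix, Matrix.sub_apply, Matrix.of_apply, scaleWeight]
    by_cases hij : (i : V) = j
    · rw [hij, Matrix.diagonal_apply_eq, Matrix.diagonal_apply_eq, tField_scaleWeight w hs]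
      ring
    · rw [Matrix.diagonal_apply_ne _ hij, Matrix.diagonal_apply_ne _ hij]
      ring
  unfold principalCofactor
  rw [h, Matrix.det_mul, Matrix.det_mul, Matrix.det_diagonal]
  ring

/-- Exponential tilting by the field amounts to a translation of the `t`-field and a change of the
weights. -/
theorem tDensity_tilt (w : V → V → ℝ) {s : V → ℝ} (hs : ∀ i, 0 < s i) {o : V}
    {t t' : {k : V // k ≠ o} → ℝ} (ht : ∀ i, pin o t' i = pin o t i + Real.log (s i)) :
    Real.exp (-(1 / 2) * ∑ i, (s i ^ 2 - 1) * tField w (pin o t') i) * tDensity w o t' *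
        ∏ k : {k : V // k ≠ o}, s k =
      Real.exp (-(1 / 2) * (∑ i, ∑ k, scaleWeight s w i k - ∑ i, ∑ k, w i k)) *
        tDensity (scaleWeight s w) o t := by
  have hp : 0 < ∏ k : {k : V // k ≠ o}, s k := Finset.prod_pos fun k _ => hs k
  have ht' : pin o t' = fun i => pin o t i + Real.log (s i) := funext ht
  unfold tDensity
  rw [principalCofactor_tMatrix_scaleWeight w hs, ← ht', Real.sqrt_mul (by positivity),
    Real.sqrt_sq hp.le]
  have h : ∀ i, tField (scaleWeight s w) (pin o t) i = s i ^ 2 * tField w (pin o t') i := fun i => by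
    rw [tField_scaleWeight w hs, ht']
  simp only [h, sub_mul, one_mul, Finset.sum_sub_distrib]
  set A := ∑ i, s i ^ 2 * tField w (pin o t') i
  set B := √(principalCofactor (tMatrix w (pin o t')) o)
  rw [← mul_assoc (Real.exp _) (Real.exp _), ← Real.exp_add, mul_comm (∏ k : {k : V // k ≠ o}, s k),
    ← mul_assoc, ← mul_assoc, ← Real.exp_add]
  congr 3
  ring

theorem sum_scaleWeight_update {w : V → V → ℝ} (hw : ∀ i j, w i j = w j i) (j : V) (h : ℝ) :
    ∑ i, ∑ k, scaleWeight (Function.update 1 j (1 + h)) w i k =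
      ∑ i, ∑ k, w i k + 2 * h * ∑ k, w j k + h ^ 2 * w j j := by
  have hs : ∀ i, Function.update (1 : V → ℝ) j (1 + h) i = 1 + if i = j then h else 0 := by
    intro i
    rcases eq_or_ne i j with rfl | hij
    · simp
    · simp [hij]
  simp only [scaleWeight, hs, add_mul, mul_add, Finset.sum_add_distrib, one_mul, mul_one, ite_mul,
    zero_mul, mul_ite, mul_zero, Finset.sum_ite_eq', Finset.mem_univ, if_true, ← Finset.mul_sum,
    Finset.sum_ite_irrel, Finset.sum_const_zero, hw _ j]
  ring

omit [DecidableEq V] in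
theorem WeightConnected.scaleWeight {w : V → V → ℝ} (hc : WeightConnected w) {s : V → ℝ}
    (hs : ∀ i, 0 < s i) : WeightConnected (scaleWeight s w) := by
  intro S hS hS'
  obtain ⟨i, hi, k, hk, h⟩ := hc S hS hS'
  exact ⟨i, hi, k, hk, mul_pos (mul_pos (hs i) (hs k)) h⟩

/-- The first moment of `u_i` when the density is weighted by `e^{t_l}`. The weight `e^{t_l}` has the
effect of moving the pin to `l`. -/
def fieldMean (w : V → V → ℝ) (l i : V) : ℝ := 1 + ∑ k, w i k - if i = l then 1 else 0

/-- The function of `h` that, up to a change of variable, is the Laplace transform of `u_j` under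
the density weighted by `e^{t_l} ∏_{i ∈ S} u_i`. -/
theorem hasDerivAt_tilted_moment {w : V → V → ℝ} (hw : ∀ i j, w i j = w j i) (l j : V)
    {S : Finset V} (hj : j ∉ S) :
    HasDerivAt (fun h : ℝ => (1 + h)⁻¹ * (if l = j then 1 + h else 1) *
        Real.exp (-(h * ∑ k, w j k + h ^ 2 / 2 * w j j)) *
        matchPoly w (fun i => fieldMean w l i + h * w i j) S)
      (-matchPoly w (fieldMean w l) (insert j S)) 0 := by
  have hid := hasDerivAt_id' (0 : ℝ)
  have h1 : HasDerivAt (fun h : ℝ => (1 + h)⁻¹) (-1) 0 := by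
    exact ((hid.const_add 1).inv (by norm_num)).congr_deriv (by norm_num)
  have h2 : HasDerivAt (fun h : ℝ => if l = j then 1 + h else 1) (if l = j then 1 else 0) 0 := by
    split_ifs
    · exact hid.const_add 1
    · exact hasDerivAt_const _ _
  have h3 : HasDerivAt (fun h : ℝ => Real.exp (-(h * ∑ k, w j k + h ^ 2 / 2 * w j j)))
      (-∑ k, w j k) 0 := by
    have := ((hid.mul_const (∑ k, w j k)).add
      (((hid.pow 2).div_const 2).mul_const (w j j))).neg.exp
    simpa using this
  refine (((h1.mul h2).mul h3).mul (hasDerivAt_matchPoly hw (fieldMean w l) (fun i => w i j)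
    S)).congr_deriv ?_
  rw [matchPoly_insert hw _ hj, fieldMean]
  rcases eq_or_ne l j with rfl | hlj
  · simp; ring
  · simp [hlj, hlj.symm]; ring

/-- The mixed moments of the field away from the pinned vertex. Tilting by `u_j` yields the Laplace
transform of `u_j` under the density weighted by `e^{t_l} ∏_{i ∈ S} u_i`; its derivative at `0` adds
`j` to `S`. -/
theorem integral_prod_tField {o : V} {S : Finset V} (ho : o ∉ S) (l : V) : ∀ {w : V → V → ℝ},
    (∀ i j, w i j = w j i) → (∀ i j, 0 ≤ w i j) → WeightConnected w →
    Integrable (fun t => (∏ i ∈ S, tField w (pin o t) i) *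
      (Real.exp (pin o t l) * tDensity w o t)) ∧
    ∫ t, (∏ i ∈ S, tField w (pin o t) i) * (Real.exp (pin o t l) * tDensity w o t) =
      gaussConst o * matchPoly w (fieldMean w l) S := by
  induction S using Finset.induction_on with
  | empty =>
    intro w hw hw0 hc
    simpa using integral_exp_mul_tDensity hw hw0 hc o l
  | insert j S hj ih =>
    intro w hw hw0 hc
    have hoj : j ≠ o := fun h => ho (h ▸ Finset.mem_insert_self _ _)
    have ih := fun {w} => @ih (fun h => ho (Finset.mem_insert_of_mem h)) w
    set g : ({k : V // k ≠ o} → ℝ) → ℝ := fun t =>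
      (∏ i ∈ S, tField w (pin o t) i) * (Real.exp (pin o t l) * tDensity w o t) with hg
    have hcf : ∀ i, Continuous fun t => tField w (pin o t) i := fun i =>
      (continuous_apply i).comp ((continuous_tField w).comp (continuous_pin o))
    have hgc : Continuous g := (continuous_finsetProd _ fun i _ => hcf i).mul
      ((Real.continuous_exp.comp ((continuous_apply l).comp (continuous_pin o))).mul
        (continuous_tDensity w o))
    have hg0 : ∀ t, 0 ≤ g t := fun t => mul_nonneg
      (Finset.prod_nonneg fun i _ => tField_nonneg hw0 _ i)
      (mul_nonneg (Real.exp_pos _).le (tDensity_nonneg _ _ _))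
    have hder : HasDerivAt (fun r : ℝ => √(1 - 2 * r) - 1) (-1) 0 := by
      have h1 : HasDerivAt (fun r : ℝ => 1 - 2 * r) (-2) 0 := by
        simpa using ((hasDerivAt_id (0 : ℝ)).const_mul 2).const_sub 1
      refine ((h1.sqrt (by norm_num)).sub_const 1).congr_deriv ?_
      norm_num
    have hder2 := hasDerivAt_tilted_moment hw l j hj
    rw [show (0 : ℝ) = √(1 - 2 * 0) - 1 by norm_num] at hder2
    have hΦ := (hder2.comp (0 : ℝ) hder).const_mul (gaussConst o)
    have main := integral_mul_of_laplace (X := fun t => tField w (pin o t) j) (μ := volume)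
      hgc.measurable hg0 (ε := 1 / 2) (by norm_num) ?_ hΦ
    · simp only [Finset.prod_insert hj, mul_assoc]
      simpa [mul_assoc] using main
    intro r hr
    -- the scaling `θ` at `j` tilts by `-(θ² - 1) / 2 = r` times the field at `j`
    have hr' : 0 < 1 - 2 * r := by have := (abs_lt.1 hr).2; linarith
    set θ := √(1 - 2 * r) with hθ
    have hθ0 : 0 < θ := Real.sqrt_pos.2 hr'
    have hθ2 : θ ^ 2 = 1 - 2 * r := Real.sq_sqrt hr'.le
    set s : V → ℝ := Function.update 1 j θ with hs
    have hsj : s j = θ := by simp [hs]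
    have hsn : ∀ i, i ≠ j → s i = 1 := fun i hi => by simp [hs, hi]
    have hs0 : ∀ i, 0 < s i := fun i => by
      rcases eq_or_ne i j with rfl | h
      · rwa [hsj]
      · rw [hsn i h]; exact one_pos
    have hprod : ∏ k : {k : V // k ≠ o}, s k = θ := by
      rw [Fintype.prod_eq_single (⟨j, hoj⟩ : {k : V // k ≠ o})]
      · exact hsj
      · exact fun k hk => hsn k fun h => hk (Subtype.ext h)
    have hsum : ∀ T, ∑ i, (s i ^ 2 - 1) * tField w T i = -2 * r * tField w T j := fun T => by
      rw [Fintype.sum_eq_single j]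
      · rw [hsj, hθ2]; ring
      · intro k hk; rw [hsn k hk]; ring
    set w' := ArborealGas.scaleWeight s w with hw'
    obtain ⟨hI, hE⟩ := @ih w' (fun i k => by simp only [hw', ArborealGas.scaleWeight, hw i k]; ring)
      (fun i k => mul_nonneg (mul_nonneg (hs0 i).le (hs0 k).le) (hw0 i k)) (hc.scaleWeight hs0)
    set a : {k : V // k ≠ o} → ℝ := fun k => Real.log (s k) with ha
    set κ := θ⁻¹ * s l * Real.exp (-(1 / 2) * (∑ i, ∑ k, w' i k - ∑ i, ∑ k, w i k)) with hκ
    have hF : (fun t => Real.exp (r * tField w (pin o t) j) * g t) = fun t =>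
        κ * ((∏ i ∈ S, tField w' (pin o (t - a)) i) *
          (Real.exp (pin o (t - a) l) * tDensity w' o (t - a))) := by
      funext t
      have ht : ∀ i, pin o t i = pin o (t - a) i + Real.log (s i) := by
        intro i
        rcases eq_or_ne i o with rfl | hi
        · simp [hsn i hoj.symm]
        · have := pin_coe o t ⟨i, hi⟩
          have h' := pin_coe o (t - a) ⟨i, hi⟩
          simp only at this h'
          rw [this, h']
          simp [ha]
      have hpin : pin o t = fun i => pin o (t - a) i + Real.log (s i) := funext ht
      have htilt := tDensity_tilt w hs0 ht
      rw [hsum, hprod] at htilt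
      have hfS : ∏ i ∈ S, tField w' (pin o (t - a)) i = ∏ i ∈ S, tField w (pin o t) i :=
        Finset.prod_congr rfl fun i hi => by
          rw [hw', tField_scaleWeight w hs0, ← hpin, hsn i (fun h => hj (h ▸ hi))]; ring
      have hel : Real.exp (pin o t l) = Real.exp (pin o (t - a) l) * s l := by
        rw [ht l, Real.exp_add, Real.exp_log (hs0 l)]
      simp only [hg, hκ]
      rw [hfS, hel]
      have e1 : Real.exp (r * tField w (pin o t) j) * tDensity w o t =
          θ⁻¹ * (Real.exp (-(1 / 2) * (∑ i, ∑ k, w' i k - ∑ i, ∑ k, w i k)) *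
            tDensity w' o (t - a)) := by
        rw [← htilt, show -(1 / 2) * (-2 * r * tField w (pin o t) j) = r * tField w (pin o t) j by
          ring]
        field_simp
      linear_combination (∏ i ∈ S, tField w (pin o t) i) * Real.exp (pin o (t - a) l) * s l * e1
    rw [hF]
    refine ⟨(hI.comp_sub_right a).const_mul κ, ?_⟩
    rw [integral_const_mul, integral_sub_right_eq_self (fun t => (∏ i ∈ S, tField w' (pin o t) i) *
          (Real.exp (pin o t l) * tDensity w' o t)) a, hE]
    have hpoly : matchPoly w' (fieldMean w' l) S =
        matchPoly w (fun i => fieldMean w l i + (θ - 1) * w i j) S := by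
      refine matchPoly_congr (fun i hi k hk => ?_) fun i hi => ?_
      · have h1 : i ≠ j := fun h => hj (h ▸ hi)
        have h2 : k ≠ j := fun h => hj (h ▸ hk)
        simp [hw', ArborealGas.scaleWeight, hsn i h1, hsn k h2]
      · have h1 : i ≠ j := fun h => hj (h ▸ hi)
        have : ∑ k, w' i k = ∑ k, w i k + (θ - 1) * w i j := by
          simp only [hw', ArborealGas.scaleWeight, hsn i h1, one_mul]
          rw [← Finset.add_sum_erase _ _ (Finset.mem_univ j),
            ← Finset.add_sum_erase _ (w i) (Finset.mem_univ j), hsj,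
            Finset.sum_congr rfl fun k hk => by rw [hsn k (Finset.ne_of_mem_erase hk), one_mul]]
          ring
        simp only [fieldMean, this]
        ring
    have hsl : s l = if l = j then 1 + (θ - 1) else 1 := by
      split_ifs with h
      · rw [h, hsj]; ring
      · exact hsn l h
    have hww : ∑ i, ∑ k, w' i k = ∑ i, ∑ k, w i k + 2 * (θ - 1) * ∑ k, w j k +
        (θ - 1) ^ 2 * w j j := by
      rw [← sum_scaleWeight_update hw, add_sub_cancel]
    rw [hpoly, hκ, hsl, hww]
    simp only [Function.comp_apply, add_sub_cancel]
    rw [show -(1 / 2) * (∑ i, ∑ k, w i k + 2 * (θ - 1) * ∑ k, w j k + (θ - 1) ^ 2 * w j j -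
      ∑ i, ∑ k, w i k) = -((θ - 1) * ∑ k, w j k + (θ - 1) ^ 2 / 2 * w j j) by ring]
    ring

end TField

/-! ### The expected determinant -/

section ForestPoly

variable {V : Type*} [Fintype V] [DecidableEq V]

/-- A principal minor, as the determinant of the matrix whose other rows are those of the identity.
-/
theorem det_ite_single (p : V → Prop) [DecidablePred p] (A : Matrix V V ℝ) :
    (Matrix.of fun i => if p i then A i else Pi.single i 1).det =
      (A.submatrix (fun k : {k // p k} => (k : V)) (fun k : {k // p k} => (k : V))).det := by
  rw [Matrix.twoBlockTriangular_det _ p]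
  · have h1 : Matrix.toSquareBlockProp (Matrix.of fun i => if p i then A i else Pi.single i 1) p =
        A.submatrix (fun k : {k // p k} => (k : V)) (fun k : {k // p k} => (k : V)) := by
      ext i j
      simp [Matrix.toSquareBlockProp, i.2]
    have h2 : Matrix.toSquareBlockProp (Matrix.of fun i => if p i then A i else Pi.single i 1)
        (fun i => ¬p i) = 1 := by
      ext i j
      simp [Matrix.toSquareBlockProp, i.2, Matrix.one_apply, Pi.single_apply, Subtype.ext_iff,
        eq_comm]
    rw [h1, h2, Matrix.det_one, mul_one]
  · intro i hi j hj
    have : j ≠ i := fun h => hi (h ▸ hj)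
    simp [hi, this]

/-- The principal minor of `-w` on `T`. -/
noncomputable def negMinor (w : V → V → ℝ) (T : Finset V) : ℝ :=
  (Matrix.of fun i => if i ∈ T then -w i else Pi.single i 1 : Matrix V V ℝ).det

theorem negMinor_congr {w w' : V → V → ℝ} {T : Finset V} (h : ∀ i ∈ T, ∀ j ∈ T, w i j = w' i j) :
    negMinor w T = negMinor w' T := by
  have key := det_ite_single (· ∈ T) (Matrix.of fun i => -w i)
  have key' := det_ite_single (· ∈ T) (Matrix.of fun i => -w' i)
  refine key.trans (Eq.trans ?_ key'.symm)
  congr 1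
  ext i j
  simp [h i i.2 j j.2]

/-- The determinant of `diag(u) - w` is multi-affine in the field `u`. -/
theorem det_rows_eq_sum (w : V → V → ℝ) (u : V → ℝ) (R : Finset V) :
    (Matrix.of fun i => if i ∈ R then (Matrix.diagonal u - Matrix.of w) i else Pi.single i 1 :
      Matrix V V ℝ).det = ∑ S ∈ R.powerset, (∏ i ∈ S, u i) * negMinor w (R \ S) := by
  set a : V → ℝ := fun i => if i ∈ R then u i else 0 with ha
  set B : V → V → ℝ := fun i => if i ∈ R then -w i else Pi.single i 1 with hB
  have h1 : (Matrix.of fun i => if i ∈ R then (Matrix.diagonal u - Matrix.of w) i else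
      Pi.single i 1 : Matrix V V ℝ) = (fun i => a i • (Pi.single i 1 : V → ℝ)) + B := by
    ext i j
    by_cases hi : i ∈ R
    · simp [ha, hB, hi, Matrix.diagonal_apply, Pi.single_apply, eq_comm, sub_eq_add_neg]
    · simp [ha, hB, hi]
  rw [h1]
  change Matrix.detRowAlternating _ = _
  rw [AlternatingMap.map_add_univ]
  have h2 : ∀ S : Finset V, Matrix.detRowAlternating
      (S.piecewise (fun i => a i • (Pi.single i 1 : V → ℝ)) B) =
      (∏ i ∈ S, a i) * Matrix.detRowAlternating (S.piecewise (fun i => Pi.single i 1) B) := by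
    intro S
    have := MultilinearMap.map_piecewise_smul
      (Matrix.detRowAlternating (n := V) (R := ℝ)).toMultilinearMap a
      (S.piecewise (fun i => Pi.single i 1) B) S
    rw [smul_eq_mul] at this
    refine Eq.trans (congrArg Matrix.detRowAlternating ?_) this
    ext i j
    by_cases hi : i ∈ S <;> simp [hi]
  rw [Finset.sum_congr rfl fun S _ => h2 S]
  symm
  refine Finset.sum_subset_zero_on_sdiff (Finset.subset_univ _) (fun S hS => ?_) fun S hS => ?_
  · have : ¬ S ⊆ R := by simpa using hS
    obtain ⟨i, hiS, hiR⟩ := Finset.not_subset.1 this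
    rw [Finset.prod_eq_zero hiS (by simp [ha, hiR]), zero_mul]
  · rw [Finset.mem_powerset] at hS
    rw [Finset.prod_congr rfl fun i hi => show u i = a i by simp [ha, hS hi]]
    congr 1
    unfold negMinor
    change Matrix.detRowAlternating _ = _
    congr 1
    ext i j
    by_cases hi : i ∈ S
    · simp [hi]
    · by_cases hR : i ∈ R <;> simp [hi, hR, hB]

/-- The value of `E[det (diag u - w)_R]` when the moments of the field `u` are the matching
polynomials in `x`. -/
noncomputable def forestPoly (w : V → V → ℝ) (x : V → ℝ) (R : Finset V) : ℝ :=
  ∑ S ∈ R.powerset, matchPoly w x S * negMinor w (R \ S)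

theorem integral_det_of_moments {α : Type*} [MeasurableSpace α] {μ : Measure α} {u : α → V → ℝ}
    {g : α → ℝ} {w : V → V → ℝ} {x : V → ℝ} {C : ℝ} {R : Finset V}
    (h : ∀ S ⊆ R, Integrable (fun t => (∏ i ∈ S, u t i) * g t) μ ∧
      ∫ t, (∏ i ∈ S, u t i) * g t ∂μ = C * matchPoly w x S) :
    Integrable (fun t => (Matrix.of fun i => if i ∈ R then (Matrix.diagonal (u t) - Matrix.of w) i
      else Pi.single i 1 : Matrix V V ℝ).det * g t) μ ∧
    ∫ t, (Matrix.of fun i => if i ∈ R then (Matrix.diagonal (u t) - Matrix.of w) i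
      else Pi.single i 1 : Matrix V V ℝ).det * g t ∂μ = C * forestPoly w x R := by
  have hfun : (fun t => (Matrix.of fun i => if i ∈ R then (Matrix.diagonal (u t) - Matrix.of w) i
      else Pi.single i 1 : Matrix V V ℝ).det * g t) = fun t =>
      ∑ S ∈ R.powerset, negMinor w (R \ S) * ((∏ i ∈ S, u t i) * g t) := by
    funext t
    rw [det_rows_eq_sum, Finset.sum_mul]
    exact Finset.sum_congr rfl fun S _ => by ring
  have hint : ∀ S ∈ R.powerset, Integrable
      (fun t => negMinor w (R \ S) * ((∏ i ∈ S, u t i) * g t)) μ := fun S hS =>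
    (h S (Finset.mem_powerset.1 hS)).1.const_mul _
  rw [hfun]
  refine ⟨integrable_finsetSum _ hint, ?_⟩
  rw [integral_finsetSum _ hint, forestPoly, Finset.mul_sum]
  refine Finset.sum_congr rfl fun S hS => ?_
  rw [integral_const_mul, (h S (Finset.mem_powerset.1 hS)).2]
  ring

/-! ### Algebraic properties of the expected determinant -/

theorem forestPoly_insert (w : V → V → ℝ) (x : V → ℝ) {R : Finset V} {j : V} (hj : j ∉ R) :
    forestPoly w x (insert j R) = ∑ S ∈ R.powerset,
      (matchPoly w x S * negMinor w (insert j (R \ S)) +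
        matchPoly w x (insert j S) * negMinor w (R \ S)) := by
  rw [forestPoly, Finset.sum_powerset_insert hj, ← Finset.sum_add_distrib]
  refine Finset.sum_congr rfl fun S hS => ?_
  have hjS : j ∉ S := fun h => hj (Finset.mem_powerset.1 hS h)
  rw [Finset.insert_sdiff_of_notMem _ hjS, Finset.insert_sdiff_insert,
    Finset.sdiff_insert_of_notMem hj]

theorem forestPoly_congr {w w' : V → V → ℝ} {x x' : V → ℝ} {R : Finset V}
    (hw : ∀ i ∈ R, ∀ j ∈ R, w i j = w' i j) (hx : ∀ i ∈ R, x i = x' i) :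
    forestPoly w x R = forestPoly w' x' R := by
  refine Finset.sum_congr rfl fun S hS => ?_
  rw [Finset.mem_powerset] at hS
  rw [matchPoly_congr (fun i hi j hj => hw i (hS hi) j (hS hj)) fun i hi => hx i (hS hi),
    negMinor_congr fun i hi j hj => hw i (Finset.sdiff_subset hi) j (Finset.sdiff_subset hj)]

/-- `forestPoly` is affine in each variable `x j`, as the field enters the determinant through
`u_j` to the first power. -/
theorem forestPoly_update {w : V → V → ℝ} (hw : ∀ i j, w i j = w j i) {x x' : V → ℝ} {s : ℝ}
    {R : Finset V} {j : V} (hj : j ∉ R) (hxj : x' j = x j + s) (hx : ∀ i ∈ R, x' i = x i) :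
    forestPoly w x' (insert j R) = forestPoly w x (insert j R) + s * forestPoly w x R := by
  rw [forestPoly_insert w x' hj, forestPoly_insert w x hj, forestPoly, Finset.mul_sum,
    ← Finset.sum_add_distrib]
  refine Finset.sum_congr rfl fun S hS => ?_
  rw [Finset.mem_powerset] at hS
  have hjS : j ∉ S := fun h => hj (hS h)
  rw [matchPoly_congr (fun _ _ _ _ => rfl) fun i hi => hx i (hS hi),
    matchPoly_update_of_mem hw (Finset.mem_insert_self j S) hxj fun i hi hij =>
      hx i (hS (Finset.mem_of_mem_insert_of_ne hi hij)), Finset.erase_insert hjS]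
  ring

theorem forestPoly_isolated {w : V → V → ℝ} (hw : ∀ i j, w i j = w j i) {x : V → ℝ}
    {R : Finset V} {j : V} (hj : j ∉ R) (hxj : x j = 1) (hwj : ∀ k, w j k = 0) :
    forestPoly w x (insert j R) = forestPoly w x R := by
  rw [forestPoly_insert w x hj, forestPoly]
  refine Finset.sum_congr rfl fun S hS => ?_
  have hjS : j ∉ S := fun h => hj (Finset.mem_powerset.1 hS h)
  have h0 : negMinor w (insert j (R \ S)) = 0 :=
    Matrix.det_eq_zero_of_row_eq_zero j fun k => by simp [hwj]
  rw [h0, matchPoly_insert hw x hjS, hxj]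
  simp [hw _ j, hwj]

theorem continuous_forestPoly {X : Type*} [TopologicalSpace X] {w : X → V → V → ℝ}
    {x : X → V → ℝ} (hw : ∀ i j, Continuous fun p => w p i j) (hx : ∀ i, Continuous fun p => x p i)
    (R : Finset V) : Continuous fun p => forestPoly (w p) (x p) R := by
  refine continuous_finsetSum _ fun S _ => (continuous_matchPoly hw hx S).mul ?_
  refine Continuous.matrix_det (continuous_matrix fun i j => ?_)
  by_cases hi : i ∈ R \ S
  · simp only [Matrix.of_apply, if_pos hi, Pi.neg_apply]
    exact (hw i j).neg
  · simpa only [Matrix.of_apply, if_neg hi] using continuous_const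

/-! ### Independence of the pinned vertex -/

/-- The vector `e^T` is in the kernel. -/
theorem det_tMatrix [Nonempty V] (w : V → V → ℝ) (T : V → ℝ) : (tMatrix w T).det = 0 := by
  refine Matrix.exists_mulVec_eq_zero_iff.1 ⟨fun i => Real.exp (T i), fun h => ?_, ?_⟩
  · have := congrFun h (Classical.arbitrary V)
    exact (Real.exp_pos _).ne' this
  · ext i
    rw [tMatrix, Matrix.sub_mulVec, Pi.sub_apply, Matrix.mulVec_diagonal, tField, Finset.sum_mul]
    simp only [Matrix.mulVec, dotProduct, Matrix.of_apply, Pi.zero_apply, ← Finset.sum_sub_distrib]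
    refine Finset.sum_eq_zero fun k _ => ?_
    rw [mul_assoc, ← Real.exp_add, sub_add_cancel, sub_self]

theorem matchPoly_fieldMean {w : V → V → ℝ} (hw : ∀ i j, w i j = w j i) {o : V} {S : Finset V}
    (ho : o ∉ S) (k : V) : matchPoly w (fieldMean w k) S =
      matchPoly w (fieldMean w o) S - if k ∈ S then matchPoly w (fieldMean w o) (S.erase k) else 0 := by
  have hoi : ∀ i ∈ S, fieldMean w o i = 1 + ∑ k, w i k := fun i hi => by
    simp [fieldMean, show i ≠ o from fun h => ho (h ▸ hi)]
  split_ifs with hk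
  · rw [matchPoly_update_of_mem hw (x := fieldMean w o) (s := -1) hk]
    · ring
    · rw [hoi k hk]; simp [fieldMean, sub_eq_add_neg]
    · intro i hi hik
      rw [hoi i hi]; simp [fieldMean, hik]
  · rw [sub_zero]
    refine matchPoly_congr (fun _ _ _ _ => rfl) fun i hi => ?_
    rw [hoi i hi]; simp [fieldMean, show i ≠ k from fun h => hk (h ▸ hi)]

/-- The moments of the field, including that of the pinned vertex `o`. Since
`u_o = ∑_k w_{ok} e^{T_k}`, they reduce to moments weighted by `e^{T_k}`. -/
theorem integral_prod_tField_univ {w : V → V → ℝ} (hw : ∀ i j, w i j = w j i)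
    (hw0 : ∀ i j, 0 ≤ w i j) (hc : WeightConnected w) (o : V) (S : Finset V) :
    Integrable (fun t => (∏ i ∈ S, tField w (pin o t) i) * tDensity w o t) ∧
    ∫ t, (∏ i ∈ S, tField w (pin o t) i) * tDensity w o t =
      gaussConst o * matchPoly w (fieldMean w o) S := by
  by_cases ho : o ∈ S
  swap
  · simpa using integral_prod_tField ho o hw hw0 hc
  have ho' : o ∉ S.erase o := Finset.notMem_erase o S
  have hint : ∀ k ∈ Finset.univ, Integrable (fun t => w o k *
      ((∏ i ∈ S.erase o, tField w (pin o t) i) * (Real.exp (pin o t k) * tDensity w o t))) :=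
    fun k _ => (integral_prod_tField ho' k hw hw0 hc).1.const_mul _
  have hfun : (fun t => (∏ i ∈ S, tField w (pin o t) i) * tDensity w o t) = fun t =>
      ∑ k, w o k * ((∏ i ∈ S.erase o, tField w (pin o t) i) *
        (Real.exp (pin o t k) * tDensity w o t)) := by
    funext t
    rw [← Finset.mul_prod_erase S _ ho]
    nth_rewrite 1 [tField]
    rw [Finset.sum_mul, Finset.sum_mul]
    refine Finset.sum_congr rfl fun k _ => ?_
    rw [pin_self, sub_zero]
    ring
  rw [hfun]
  refine ⟨integrable_finsetSum _ hint, ?_⟩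
  rw [integral_finsetSum _ hint]
  have hk : ∀ k, ∫ t, w o k * ((∏ i ∈ S.erase o, tField w (pin o t) i) *
        (Real.exp (pin o t k) * tDensity w o t)) = gaussConst o *
        (w o k * matchPoly w (fieldMean w o) (S.erase o) - if k ∈ S.erase o then
          w k o * matchPoly w (fieldMean w o) ((S.erase o).erase k) else 0) := fun k => by
    rw [integral_const_mul, (integral_prod_tField ho' k hw hw0 hc).2, matchPoly_fieldMean hw ho' k,
      hw k o]
    split_ifs <;> ring
  rw [Finset.sum_congr rfl fun k _ => hk k, ← Finset.mul_sum, matchPoly_eq hw _ ho,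
    Finset.sum_sub_distrib, ← Finset.sum_mul, ← Finset.sum_filter, Finset.filter_mem_eq_inter,
    Finset.univ_inter]
  simp [fieldMean]

/-- The forest polynomial of the weighted graph, as an expected determinant; see
`forestSum_eq` for its expansion over forests. -/
noncomputable def expDet (w : V → V → ℝ) : ℝ :=
  forestPoly w (fun i => 1 + ∑ k, w i k) Finset.univ

/-- Weighting by `e^{t_j}` lowers the mean of `u_j` by one, which subtracts the minor without `j`. -/
theorem forestPoly_fieldMean {w : V → V → ℝ} (hw : ∀ i j, w i j = w j i) {R : Finset V} {j : V}
    (hj : j ∉ R) : forestPoly w (fieldMean w j) (insert j R) =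
      forestPoly w (fun i => 1 + ∑ k, w i k) (insert j R) -
        forestPoly w (fun i => 1 + ∑ k, w i k) R := by
  rw [forestPoly_update hw (x := fun i => 1 + ∑ k, w i k) (s := -1) hj]
  · ring
  · simp [fieldMean, sub_eq_add_neg]
  · intro i hi
    simp [fieldMean, show i ≠ j from fun h => hj (h ▸ hi)]

/-- Since `diag(u) - w` is singular, its expected determinant with `o` pinned vanishes; this
determinant is affine in the mean of `u_o`, which is one less than that of an unpinned vertex. -/
theorem expDet_eq_erase_of_connected {w : V → V → ℝ} (hw : ∀ i j, w i j = w j i)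
    (hw0 : ∀ i j, 0 ≤ w i j) (hc : WeightConnected w) (o : V) :
    expDet w = forestPoly w (fun i => 1 + ∑ k, w i k) (Finset.univ.erase o) := by
  have : Nonempty V := ⟨o⟩
  have h := (integral_det_of_moments (R := Finset.univ)
    fun S _ => integral_prod_tField_univ hw hw0 hc o S).2
  have h0 : ∀ T, (Matrix.of fun i => if i ∈ Finset.univ then
      (Matrix.diagonal (tField w T) - Matrix.of w) i else Pi.single i 1 : Matrix V V ℝ).det = 0 := by
    intro T
    rw [← det_tMatrix w T]
    congr 1
    ext i j
    simp [tMatrix]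
  simp only [h0, zero_mul, integral_zero] at h
  have h1 := (mul_eq_zero.1 h.symm).resolve_left (gaussConst_pos o).ne'
  rw [← Finset.insert_erase (Finset.mem_univ o),
    forestPoly_fieldMean hw (Finset.notMem_erase o _), sub_eq_zero,
    Finset.insert_erase (Finset.mem_univ o)] at h1
  exact h1

/-- The expected determinant does not depend on the pinned vertex. -/
theorem expDet_eq_erase {w : V → V → ℝ} (hw : ∀ i j, w i j = w j i)
    (hw0 : ∀ i j, 0 ≤ w i j) (o : V) :
    expDet w = forestPoly w (fun i => 1 + ∑ k, w i k) (Finset.univ.erase o) := by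
  -- both sides are continuous, so that the weights may be assumed to be positive
  have hcont : ∀ R : Finset V, Continuous fun ε : ℝ =>
      forestPoly (fun i j => w i j + ε) (fun i => 1 + ∑ k, (w i k + ε)) R := fun R =>
    continuous_forestPoly (fun i j => by fun_prop) (fun i => by fun_prop) R
  have h1 := ((hcont Finset.univ).tendsto 0).mono_left (nhdsWithin_le_nhds (s := Set.Ioi 0))
  have h2 := ((hcont (Finset.univ.erase o)).tendsto 0).mono_left
    (nhdsWithin_le_nhds (s := Set.Ioi 0))
  have heq : (fun ε : ℝ => forestPoly (fun i j => w i j + ε) (fun i => 1 + ∑ k, (w i k + ε))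
      Finset.univ) =ᶠ[nhdsWithin 0 (Set.Ioi 0)] fun ε : ℝ =>
      forestPoly (fun i j => w i j + ε) (fun i => 1 + ∑ k, (w i k + ε)) (Finset.univ.erase o) := by
    filter_upwards [self_mem_nhdsWithin] with ε hε
    have hε : 0 < ε := hε
    have hpos : ∀ i j, 0 < w i j + ε := fun i j => add_pos_of_nonneg_of_pos (hw0 i j) hε
    refine expDet_eq_erase_of_connected (fun i j => by rw [hw]) (fun i j => (hpos i j).le) ?_ o
    intro S hS hS'
    obtain ⟨i, hi⟩ := hS
    obtain ⟨k, hk⟩ : ∃ k, k ∉ S := by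
      by_contra! h
      exact hS' (Finset.eq_univ_iff_forall.2 h)
    exact ⟨i, hi, k, hk, hpos i k⟩
  have := tendsto_nhds_unique (h1.congr' heq) h2
  simpa [expDet] using this

/-! ### Deletion and contraction -/

/-- The weights of a single edge `pq` of weight `s`. -/
def edgeWeight (p q : V) (s : ℝ) (a b : V) : ℝ :=
  (if a = p ∧ b = q then s else 0) + if a = q ∧ b = p then s else 0

/-- The weights on the graph in which every vertex `a` is identified with `f a`. -/
def pushWeight (f : V → V) (w : V → V → ℝ) (a b : V) : ℝ :=
  ∑ a', ∑ b', if f a' = a ∧ f b' = b then w a' b' else 0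

theorem pushWeight_comm {f : V → V} {w : V → V → ℝ} (hw : ∀ i j, w i j = w j i) (a b : V) :
    pushWeight f w a b = pushWeight f w b a := by
  unfold pushWeight
  rw [Finset.sum_comm]
  refine Finset.sum_congr rfl fun _ _ => Finset.sum_congr rfl fun _ _ => ?_
  rw [hw]
  exact if_congr and_comm rfl rfl

theorem pushWeight_nonneg {f : V → V} {w : V → V → ℝ} (hw0 : ∀ i j, 0 ≤ w i j) (a b : V) :
    0 ≤ pushWeight f w a b :=
  Finset.sum_nonneg fun _ _ => Finset.sum_nonneg fun _ _ => by
    split_ifs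
    exacts [hw0 _ _, le_rfl]

theorem sum_pushWeight (f : V → V) (w : V → V → ℝ) (a : V) :
    ∑ b, pushWeight f w a b = ∑ a', if f a' = a then ∑ b', w a' b' else 0 := by
  unfold pushWeight
  rw [Finset.sum_comm]
  refine Finset.sum_congr rfl fun a' _ => ?_
  rw [Finset.sum_comm]
  by_cases h : f a' = a <;> simp [h]

/-- The map identifying the vertex `q` with `p`. -/
def mergeMap (p q : V) (a : V) : V := if a = q then p else a

omit [Fintype V] in
theorem mergeMap_eq_iff {p q a b : V} (hp : a ≠ p) (hq : a ≠ q) : mergeMap p q b = a ↔ b = a := by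
  unfold mergeMap
  split_ifs with h
  · subst h; exact ⟨fun h => absurd h.symm hp, fun h => absurd h.symm hq⟩
  · rfl

omit [Fintype V] in
theorem mergeMap_ne {p q : V} (hpq : p ≠ q) (b : V) : mergeMap p q b ≠ q := by
  unfold mergeMap
  split_ifs with h
  exacts [hpq, h]

theorem sum_edgeWeight_of_ne {p q : V} (s : ℝ) {a : V} (hp : a ≠ p) (hq : a ≠ q) :
    ∑ b, edgeWeight p q s a b = 0 := by
  simp [edgeWeight, hp, hq]

/-- A loop does not contribute, as is seen by pinning its vertex. -/
theorem expDet_add_loop {w : V → V → ℝ} (hw : ∀ i j, w i j = w j i) (hw0 : ∀ i j, 0 ≤ w i j)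
    {s : ℝ} (hs : 0 ≤ s) (p : V) :
    expDet (fun a b => w a b + edgeWeight p p s a b) = expDet w := by
  rw [expDet_eq_erase hw hw0 p, expDet_eq_erase (o := p)]
  · refine forestPoly_congr (fun i hi j _ => ?_) fun i hi => ?_
    · simp [edgeWeight, Finset.ne_of_mem_erase hi]
    · have := Finset.ne_of_mem_erase hi
      rw [Finset.sum_add_distrib, sum_edgeWeight_of_ne s this this, add_zero]
  · intro i j; simp only [edgeWeight, hw i j, and_comm]
  · intro i j
    have := hw0 i j
    unfold edgeWeight; positivity

/-- Contracting the edge `pq` amounts to removing `q` when `p` is pinned, since the edges from `q`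
become edges from `p`. -/
theorem expDet_pushWeight_merge {w : V → V → ℝ} (hw : ∀ i j, w i j = w j i)
    (hw0 : ∀ i j, 0 ≤ w i j) {p q : V} (hpq : p ≠ q) :
    expDet (pushWeight (mergeMap p q) w) =
      forestPoly w (fun i => 1 + ∑ k, w i k) ((Finset.univ.erase p).erase q) := by
  have hq : q ∈ Finset.univ.erase p := by simp [hpq.symm]
  have hq0 : ∀ k, pushWeight (mergeMap p q) w q k = 0 := fun k => by
    simp [pushWeight, mergeMap_ne hpq]
  rw [expDet_eq_erase (pushWeight_comm hw) (pushWeight_nonneg hw0) p, ← Finset.insert_erase hq,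
    forestPoly_isolated (pushWeight_comm hw) (Finset.notMem_erase q _) (by simp [hq0]) hq0,
    Finset.insert_erase hq]
  refine forestPoly_congr (fun i hi j hj => ?_) fun i hi => ?_
  · simp only [Finset.mem_erase, Finset.mem_univ, and_true] at hi hj
    simp only [pushWeight, mergeMap_eq_iff hi.2 hi.1, mergeMap_eq_iff hj.2 hj.1]
    rw [Fintype.sum_eq_single i fun a ha => by simp [ha]]
    simp
  · simp only [Finset.mem_erase, Finset.mem_univ, and_true] at hi
    rw [sum_pushWeight]
    simp [mergeMap_eq_iff hi.2 hi.1]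

/-- Pinning `p` makes the expected determinant affine in the weight of the edge `pq`, the slope
being the expected determinant on the graph with that edge contracted. -/
theorem expDet_add_edge {w : V → V → ℝ} (hw : ∀ i j, w i j = w j i) (hw0 : ∀ i j, 0 ≤ w i j)
    {s : ℝ} (hs : 0 ≤ s) {p q : V} (hpq : p ≠ q) :
    expDet (fun a b => w a b + edgeWeight p q s a b) =
      expDet w + s * expDet (pushWeight (mergeMap p q) w) := by
  have hq : q ∈ Finset.univ.erase p := by simp [hpq.symm]
  have h := forestPoly_update hw (Finset.notMem_erase q (Finset.univ.erase p)) (s := s)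
    (x := fun i => 1 + ∑ k, w i k) (x' := fun i => 1 + ∑ k, (w i k + edgeWeight p q s i k)) ?_ ?_
  · rw [Finset.insert_erase hq] at h
    rw [expDet_pushWeight_merge hw hw0 hpq, expDet_eq_erase hw hw0 p, ← h, expDet_eq_erase (o := p)]
    · refine forestPoly_congr (fun i hi j hj => ?_) fun i hi => rfl
      simp [edgeWeight, Finset.ne_of_mem_erase hi, Finset.ne_of_mem_erase hj]
    · intro i j; simp only [edgeWeight, hw i j, and_comm, add_comm]
    · intro i j
      have := hw0 i j
      unfold edgeWeight; positivity
  · rw [Finset.sum_add_distrib, ← add_assoc]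
    congr 1
    simp [edgeWeight, hpq.symm]
  · intro i hi
    simp only [Finset.mem_erase, Finset.mem_univ, and_true] at hi
    rw [Finset.sum_add_distrib, sum_edgeWeight_of_ne s hi.2 hi.1, add_zero]

theorem expDet_zero : expDet (fun _ _ => 0 : V → V → ℝ) = 1 := by
  have h : ∀ R : Finset V, forestPoly (fun _ _ => 0) (fun _ => 1) R = 1 := by
    intro R
    induction R using Finset.induction_on with
    | empty =>
      have : (Matrix.of fun i => Pi.single i 1 : Matrix V V ℝ) = 1 := by
        ext i j
        simp [Matrix.one_apply, Pi.single_apply, eq_comm]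
      simp [forestPoly, negMinor, this]
    | insert j R hj ih =>
      rw [forestPoly_isolated (fun _ _ => rfl) hj rfl fun _ => rfl, ih]
  simpa [expDet] using h Finset.univ

end ForestPoly

/-! ### Sums over forests -/

section Forests

variable {V : Type*}

theorem reachable_sup_edge_iff {H : SimpleGraph V} {i j a b : V} :
    (H ⊔ SimpleGraph.edge i j).Reachable a b ↔ H.Reachable a b ∨
      (H.Reachable a i ∧ H.Reachable j b) ∨ (H.Reachable a j ∧ H.Reachable i b) := by
  constructor
  · rintro ⟨p⟩
    induction p with
    | nil => exact Or.inl (SimpleGraph.Reachable.refl _)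
    | @cons u v x h p ih =>
      rcases h with h | h
      · have huv : H.Reachable u v := h.reachable
        rcases ih with h1 | ⟨h1, h2⟩ | ⟨h1, h2⟩
        · exact Or.inl (huv.trans h1)
        · exact Or.inr (Or.inl ⟨huv.trans h1, h2⟩)
        · exact Or.inr (Or.inr ⟨huv.trans h1, h2⟩)
      · rw [SimpleGraph.edge_adj] at h
        rcases h.1 with ⟨rfl, rfl⟩ | ⟨rfl, rfl⟩
        · rcases ih with h1 | ⟨_, h2⟩ | ⟨_, h2⟩
          · exact Or.inr (Or.inl ⟨.refl _, h1⟩)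
          · exact Or.inr (Or.inl ⟨.refl _, h2⟩)
          · exact Or.inl h2
        · rcases ih with h1 | ⟨_, h2⟩ | ⟨_, h2⟩
          · exact Or.inr (Or.inr ⟨.refl _, h1⟩)
          · exact Or.inl h2
          · exact Or.inr (Or.inr ⟨.refl _, h2⟩)
  · have hij : (H ⊔ SimpleGraph.edge i j).Reachable i j := by
      by_cases h : i = j
      · rw [h]
      · exact SimpleGraph.Adj.reachable (Or.inr (by simp [SimpleGraph.edge_adj, h]))
    rintro (h | ⟨h1, h2⟩ | ⟨h1, h2⟩)
    · exact h.mono le_sup_left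
    · exact ((h1.mono le_sup_left).trans hij).trans (h2.mono le_sup_left)
    · exact ((h1.mono le_sup_left).trans hij.symm).trans (h2.mono le_sup_left)

variable [DecidableEq V]

theorem fromEdgeSet_insert (i j : V) (K : Finset (Sym2 V)) :
    SimpleGraph.fromEdgeSet ((insert s(i, j) K : Finset (Sym2 V)) : Set (Sym2 V)) =
      SimpleGraph.fromEdgeSet (K : Set (Sym2 V)) ⊔ SimpleGraph.edge i j := by
  rw [Finset.coe_insert, Set.insert_eq, Set.union_comm, SimpleGraph.fromEdgeSet_union,
    SimpleGraph.edge]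

open Classical in
/-- The sum of `β ^ |F|` over the edge sets `F ⊆ E` disjoint from `K` such that `F ∪ K` is a
forest, that is, over the forests of the graph with edge set `E` in which `K` is contracted. -/
noncomputable def forestSum (β : ℝ) (E K : Finset (Sym2 V)) : ℝ :=
  ∑ F ∈ E.powerset with Disjoint F K ∧
    (SimpleGraph.fromEdgeSet ((F ∪ K : Finset (Sym2 V)) : Set (Sym2 V))).IsAcyclic, β ^ F.card

open Classical in
theorem forestSum_insert (β : ℝ) {E K : Finset (Sym2 V)} {e : Sym2 V} (he : e ∉ E) :
    forestSum β (insert e E) K = forestSum β E K + β * ∑ F ∈ E.powerset with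
      Disjoint (insert e F) K ∧ (SimpleGraph.fromEdgeSet
        ((insert e F ∪ K : Finset (Sym2 V)) : Set (Sym2 V))).IsAcyclic, β ^ F.card := by
  unfold forestSum
  rw [Finset.sum_filter, Finset.sum_powerset_insert he, ← Finset.sum_filter, Finset.mul_sum,
    ← Finset.sum_filter]
  congr 1
  rw [Finset.sum_filter, Finset.sum_filter]
  refine Finset.sum_congr rfl fun F hF => ?_
  have : e ∉ F := fun h => he (Finset.mem_powerset.1 hF h)
  rw [Finset.card_insert_of_notMem this, pow_succ']

theorem forestSum_insert_of_reachable (β : ℝ) {E K : Finset (Sym2 V)} {i j : V} (hij : i ≠ j)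
    (he : s(i, j) ∉ E) (hr : (SimpleGraph.fromEdgeSet (K : Set (Sym2 V))).Reachable i j) :
    forestSum β (insert s(i, j) E) K = forestSum β E K := by
  classical
  rw [forestSum_insert β he, Finset.filter_false_of_mem, Finset.sum_empty, mul_zero, add_zero]
  rintro F hF ⟨hd, ha⟩
  rw [Finset.disjoint_insert_left] at hd
  rw [Finset.insert_union, fromEdgeSet_insert, SimpleGraph.isAcyclic_sup_fromEdgeSet_iff] at ha
  have hr' := hr.mono (SimpleGraph.fromEdgeSet_mono
    (Finset.coe_subset.2 (Finset.subset_union_right (s₁ := F))))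
  have hadj := (ha.2 hr').resolve_left hij
  rw [SimpleGraph.fromEdgeSet_adj, Finset.mem_coe, Finset.mem_union] at hadj
  rcases hadj.1 with h | h
  · exact he (Finset.mem_powerset.1 hF h)
  · exact hd.1 h

theorem forestSum_insert_of_not_reachable (β : ℝ) {E K : Finset (Sym2 V)} {i j : V} (hij : i ≠ j)
    (he : s(i, j) ∉ E) (hr : ¬(SimpleGraph.fromEdgeSet (K : Set (Sym2 V))).Reachable i j) :
    forestSum β (insert s(i, j) E) K =
      forestSum β E K + β * forestSum β E (insert s(i, j) K) := by
  classical
  rw [forestSum_insert β he]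
  congr 2
  unfold forestSum
  congr 1
  refine Finset.filter_congr fun F hF => ?_
  have h1 : s(i, j) ∉ F := fun h => he (Finset.mem_powerset.1 hF h)
  have h2 : s(i, j) ∉ K := fun h => hr (SimpleGraph.Adj.reachable (by simp [h, hij]))
  rw [Finset.disjoint_insert_left, Finset.disjoint_insert_right, Finset.union_insert,
    Finset.insert_union]
  simp [h1, h2]

variable [Fintype V]

/-- The weights of the graph with edge set `E`. -/
def setWeight (β : ℝ) (E : Finset (Sym2 V)) (x y : V) : ℝ := if s(x, y) ∈ E then β else 0

omit [Fintype V] in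
theorem setWeight_comm (β : ℝ) (E : Finset (Sym2 V)) (x y : V) :
    setWeight β E x y = setWeight β E y x := by
  rw [setWeight, setWeight, Sym2.eq_swap]

omit [Fintype V] in
theorem setWeight_nonneg {β : ℝ} (hβ : 0 ≤ β) (E : Finset (Sym2 V)) (x y : V) :
    0 ≤ setWeight β E x y := by
  unfold setWeight; positivity

theorem pushWeight_setWeight_insert (β : ℝ) {E : Finset (Sym2 V)} {i j : V} (hij : i ≠ j)
    (he : s(i, j) ∉ E) (c : V → V) :
    pushWeight c (setWeight β (insert s(i, j) E)) = fun a b =>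
      pushWeight c (setWeight β E) a b + edgeWeight (c i) (c j) β a b := by
  have h : ∀ x y, setWeight β (insert s(i, j) E) x y = setWeight β E x y +
      ((if x = i then if y = j then β else 0 else 0) +
        if x = j then if y = i then β else 0 else 0) := by
    intro x y
    simp only [setWeight, Finset.mem_insert, Sym2.eq_iff]
    by_cases h1 : x = i ∧ y = j
    · obtain ⟨rfl, rfl⟩ := h1
      simp [he, hij]
    by_cases h2 : x = j ∧ y = i
    · obtain ⟨rfl, rfl⟩ := h2
      simp [hij]
      rw [Sym2.eq_swap] at he
      simp [he]
    · simp only [h1, h2, false_or, or_self, ← ite_and, if_false, add_zero]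
  funext a b
  simp only [pushWeight, h]
  have hadd : ∀ (p : Prop) [Decidable p] (r s : ℝ), (if p then r + s else 0) =
      (if p then r else 0) + if p then s else 0 := fun p _ r s => by split_ifs <;> simp
  simp only [hadd, Finset.sum_add_distrib]
  congr 1
  unfold edgeWeight
  congr 1
  · rw [Fintype.sum_eq_single i fun x hx => by simp [hx],
      Fintype.sum_eq_single j fun y hy => by simp [hy]]
    simp [eq_comm]
  · rw [Fintype.sum_eq_single j fun x hx => by simp [hx],
      Fintype.sum_eq_single i fun y hy => by simp [hy]]
    simp [eq_comm]

omit [DecidableEq V] in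
theorem sum_comm_four (g : V → V → V → V → ℝ) :
    ∑ a, ∑ b, ∑ x, ∑ y, g a b x y = ∑ x, ∑ y, ∑ a, ∑ b, g a b x y := by
  rw [Finset.sum_congr rfl fun a _ => Finset.sum_comm, Finset.sum_comm]
  refine Finset.sum_congr rfl fun x _ => ?_
  rw [Finset.sum_congr rfl fun a _ => Finset.sum_comm, Finset.sum_comm]

theorem pushWeight_comp (f c : V → V) (w : V → V → ℝ) :
    pushWeight (f ∘ c) w = pushWeight f (pushWeight c w) := by
  funext a b
  have hite : ∀ (p : Prop) [Decidable p] (g : V → V → ℝ), (if p then ∑ x, ∑ y, g x y else 0) =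
      ∑ x, ∑ y, if p then g x y else 0 := fun p _ g => by split_ifs <;> simp
  simp only [pushWeight, hite]
  rw [sum_comm_four]
  refine Finset.sum_congr rfl fun x _ => Finset.sum_congr rfl fun y _ => ?_
  rw [Fintype.sum_eq_single (c x) fun a' ha' => ?_, Fintype.sum_eq_single (c y) fun b' hb' => ?_]
  · simp
  · simp [hb'.symm]
  · simp [ha'.symm]

@[simp]
theorem pushWeight_id (w : V → V → ℝ) : pushWeight id w = w := by
  funext a b
  rw [pushWeight, Fintype.sum_eq_single a fun x hx => by simp [hx],
    Fintype.sum_eq_single b fun y hy => by simp [hy]]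
  simp

/-- The expected determinant and the sum over forests satisfy the same deletion–contraction
recursion. The map `c` labels the components of the set `K` of contracted edges. -/
theorem forestSum_eq {β : ℝ} (hβ : 0 ≤ β) {E : Finset (Sym2 V)} (hE : ∀ e ∈ E, ¬e.IsDiag) :
    ∀ (K : Finset (Sym2 V)) (c : V → V),
      (SimpleGraph.fromEdgeSet (K : Set (Sym2 V))).IsAcyclic →
      (∀ a b, c a = c b ↔ (SimpleGraph.fromEdgeSet (K : Set (Sym2 V))).Reachable a b) →
      forestSum β E K = expDet (pushWeight c (setWeight β E)) := by
  induction E using Finset.induction_on with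
  | empty =>
    intro K c hK _
    have h0 : pushWeight c (setWeight β ∅) = fun _ _ => 0 := by
      funext a b
      simp [pushWeight, setWeight]
    classical
    rw [h0, expDet_zero, forestSum, Finset.powerset_empty, Finset.filter_true_of_mem]
    · simp
    · intro F hF
      rw [Finset.mem_singleton.1 hF]
      simpa using hK
  | insert e E he ih =>
    intro K c hK hc
    have ih := ih fun e h => hE e (Finset.mem_insert_of_mem h)
    have hed : ¬e.IsDiag := hE e (Finset.mem_insert_self _ _)
    induction e with | h i j => ?_
    rw [Sym2.mk_isDiag_iff] at hed
    have hcomm := pushWeight_comm (f := c) (setWeight_comm β E)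
    have hnn := pushWeight_nonneg (f := c) (setWeight_nonneg hβ E)
    rw [pushWeight_setWeight_insert β hed he]
    by_cases hr : c i = c j
    · rw [forestSum_insert_of_reachable β hed he ((hc i j).1 hr), hr,
        expDet_add_loop hcomm hnn hβ, ih K c hK hc]
    · have hr' := fun h => hr ((hc i j).2 h)
      rw [forestSum_insert_of_not_reachable β hed he hr', expDet_add_edge hcomm hnn hβ hr,
        ih K c hK hc, ← pushWeight_comp, ih (insert s(i, j) K) (mergeMap (c i) (c j) ∘ c)]
      · rw [fromEdgeSet_insert]
        exact hK.sup_edge_of_not_reachable hr'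
      · intro a b
        rw [fromEdgeSet_insert, reachable_sup_edge_iff, ← hc, ← hc, ← hc, ← hc, ← hc]
        simp only [Function.comp_apply, mergeMap]
        by_cases ha : c a = c j <;> by_cases hb : c b = c j
        · simp [ha, hb]
        · simp [ha, hb, Ne.symm hb, Ne.symm hr]
        · simp [ha, hb, eq_comm]
        · simp [ha, hb, Ne.symm hb]

end Forests

/-! ### Principal cofactors of the Laplacian -/

section Laplacian

variable {V : Type*} [Fintype V] [DecidableEq V]

theorem principalCofactor_eq_adjugate (A : Matrix V V ℝ) (v : V) :
    principalCofactor A v = A.adjugate v v := by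
  rw [Matrix.adjugate_apply, principalCofactor, ← det_ite_single (· ≠ v)]
  congr 1
  ext i j
  by_cases h : i = v
  · subst h; simp
  · simp [h]

theorem adjugate_eq_of_mulVec_one {A : Matrix V V ℝ} (h : A.mulVec 1 = 0) (v o : V) :
    A.adjugate v o = A.adjugate o o := by
  have hdet : (A.updateRow o (Pi.single v 1 + (-1 : ℝ) • Pi.single o 1)).det = 0 := by
    refine Matrix.exists_mulVec_eq_zero_iff.1 ⟨1, fun h1 => ?_, ?_⟩
    · exact one_ne_zero (congrFun h1 o)
    · ext i
      by_cases hi : i = o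
      · subst hi
        simp [Matrix.mulVec, dotProduct, Finset.sum_add_distrib]
      · have := congrFun h i
        simpa [Matrix.mulVec, hi] using this
  rw [Matrix.det_updateRow_add, Matrix.det_updateRow_smul] at hdet
  rw [Matrix.adjugate_apply, Matrix.adjugate_apply]
  linarith

/-- The principal cofactors of a symmetric matrix with vanishing row sums are all equal. -/
theorem principalCofactor_eq_of_mulVec_one {A : Matrix V V ℝ} (hA : A.IsSymm)
    (h : A.mulVec 1 = 0) (v o : V) : principalCofactor A v = principalCofactor A o := by
  have hsymm : A.adjugate o v = A.adjugate v o := by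
    conv_lhs => rw [← hA.eq, ← Matrix.adjugate_transpose]
    rfl
  rw [principalCofactor_eq_adjugate, principalCofactor_eq_adjugate,
    ← adjugate_eq_of_mulVec_one h v o, ← hsymm, adjugate_eq_of_mulVec_one h o v]

variable (G : SimpleGraph V) [DecidableRel G.Adj]

theorem setWeight_edgeFinset (β : ℝ) (i j : V) :
    setWeight β G.edgeFinset i j = if G.Adj i j then β else 0 := by
  simp [setWeight]

theorem sum_neighborFinset_mul (β : ℝ) (f : V → ℝ) (i : V) :
    ∑ k ∈ G.neighborFinset i, β * f k = ∑ k, setWeight β G.edgeFinset i k * f k := by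
  simp [setWeight_edgeFinset, SimpleGraph.neighborFinset_eq_filter, Finset.sum_filter]

theorem isSymm_negLaplacian (β : ℝ) (T : V → ℝ) : (negLaplacian G β T).IsSymm := by
  ext i j
  rcases eq_or_ne i j with rfl | h
  · rfl
  · simp [negLaplacian, h, h.symm, G.adj_comm, add_comm]

theorem negLaplacian_mulVec_one (β : ℝ) (T : V → ℝ) : (negLaplacian G β T).mulVec 1 = 0 := by
  ext i
  rw [negLaplacian_mulVec]
  simp

/-- Conjugation by `e^T` turns the operator `diag(u) - w` into the Laplacian. -/
theorem negLaplacian_apply_eq (β : ℝ) (T : V → ℝ) (i j : V) :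
    negLaplacian G β T i j =
      Real.exp (T i) * tMatrix (setWeight β G.edgeFinset) T i j * Real.exp (T j) := by
  rcases eq_or_ne i j with rfl | h
  · simp only [negLaplacian, tMatrix, Matrix.of_apply, if_true, Matrix.sub_apply,
      Matrix.diagonal_apply_eq, setWeight_edgeFinset, SimpleGraph.irrefl, if_false, sub_zero]
    rw [sum_neighborFinset_mul, tField, Finset.mul_sum, Finset.sum_mul]
    refine Finset.sum_congr rfl fun k _ => ?_
    have : Real.exp (T i + T k) = Real.exp (T i) * Real.exp (T k - T i) * Real.exp (T i) := by
      rw [← Real.exp_add, ← Real.exp_add]; congr 1; ring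
    rw [this]; ring
  · simp only [negLaplacian, tMatrix, Matrix.of_apply, if_neg h, Matrix.sub_apply,
      Matrix.diagonal_apply_ne _ h, setWeight_edgeFinset]
    split_ifs
    · rw [Real.exp_add]; ring
    · simp

theorem principalCofactor_negLaplacian (β : ℝ) (o : V) (t : {k : V // k ≠ o} → ℝ) :
    principalCofactor (negLaplacian G β (pin o t)) o = (∏ k : {k : V // k ≠ o}, Real.exp (t k)) ^ 2 *
      principalCofactor (tMatrix (setWeight β G.edgeFinset) (pin o t)) o := by
  have h : (negLaplacian G β (pin o t)).submatrix (fun k : {k : V // k ≠ o} => (k : V))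
      (fun k : {k : V // k ≠ o} => (k : V)) =
      Matrix.diagonal (fun k : {k : V // k ≠ o} => Real.exp (t k)) *
        (tMatrix (setWeight β G.edgeFinset) (pin o t)).submatrix
          (fun k : {k : V // k ≠ o} => (k : V)) (fun k : {k : V // k ≠ o} => (k : V)) *
        Matrix.diagonal (fun k : {k : V // k ≠ o} => Real.exp (t k)) := by
    ext i j
    rw [Matrix.mul_diagonal, Matrix.diagonal_mul, Matrix.submatrix_apply, negLaplacian_apply_eq,
      pin_coe, pin_coe, Matrix.submatrix_apply]
  unfold principalCofactor
  rw [h, Matrix.det_mul, Matrix.det_mul, Matrix.det_diagonal]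
  ring

omit [DecidableEq V] in
theorem sum_sum_symm (f : V → V → ℝ) : ∑ i, ∑ k, f i k = ∑ i, ∑ k, (f i k + f k i) / 2 := by
  have h : ∑ i, ∑ k, f k i = ∑ i, ∑ k, f i k := Finset.sum_comm
  simp only [← Finset.sum_div, Finset.sum_add_distrib, h]
  ring

theorem posSemidef_negLaplacian {β : ℝ} (hβ : 0 ≤ β) (T : V → ℝ) :
    (negLaplacian G β T).PosSemidef := by
  refine Matrix.PosSemidef.of_dotProduct_mulVec_nonneg ?_ fun f => ?_
  · rw [Matrix.IsHermitian, Matrix.conjTranspose_eq_transpose_of_trivial]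
    exact (isSymm_negLaplacian G β T).eq
  have h : star f ⬝ᵥ (negLaplacian G β T).mulVec f = ∑ i, ∑ k,
      f i * (setWeight β G.edgeFinset i k * (Real.exp (T i + T k) * (f i - f k))) := by
    simp only [dotProduct, star_trivial, negLaplacian_mulVec, mul_assoc, sum_neighborFinset_mul]
    refine Finset.sum_congr rfl fun i _ => ?_
    rw [← Finset.sum_neg_distrib, Finset.mul_sum]
    exact Finset.sum_congr rfl fun k _ => by ring
  rw [h, sum_sum_symm]
  refine Finset.sum_nonneg fun i _ => Finset.sum_nonneg fun k _ => ?_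
  have h1 := setWeight_nonneg hβ G.edgeFinset i k
  have h2 := (Real.exp_pos (T i + T k)).le
  rw [setWeight_comm β _ k i, add_comm (T k)]
  have : (f i * (setWeight β G.edgeFinset i k * (Real.exp (T i + T k) * (f i - f k))) +
      f k * (setWeight β G.edgeFinset i k * (Real.exp (T i + T k) * (f k - f i)))) / 2 =
      setWeight β G.edgeFinset i k * Real.exp (T i + T k) * (f i - f k) ^ 2 / 2 := by ring
  rw [this]
  positivity

/-! ### The density as a determinant times the `H^{2|2}` density -/

/-- The exponent `3/2` splits as `1 + 1/2`: the density is a constant times the determinant of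
`diag(u) - w` away from `o` times the `H^{2|2}` density. -/
theorem density_eq {β : ℝ} (hβ : 0 ≤ β) (o v : V) (t : {k : V // k ≠ o} → ℝ) :
    density G β o v t = Real.exp (-β * G.edgeFinset.card) *
      (principalCofactor (tMatrix (setWeight β G.edgeFinset) (pin o t)) o *
        tDensity (setWeight β G.edgeFinset) o t) := by
  set w := setWeight β G.edgeFinset with hw
  set T := pin o t with hT
  set D := principalCofactor (tMatrix w T) o with hD
  set P := ∏ k : {k : V // k ≠ o}, Real.exp (t k) with hP
  have hP0 : 0 < P := Finset.prod_pos fun _ _ => Real.exp_pos _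
  have hcof : principalCofactor (negLaplacian G β T) v = P ^ 2 * D := by
    rw [principalCofactor_eq_of_mulVec_one (isSymm_negLaplacian G β T)
      (negLaplacian_mulVec_one G β T) v o, principalCofactor_negLaplacian]
  have hD0 : 0 ≤ D := by
    have h : 0 ≤ P ^ 2 * D := by
      rw [← hcof]
      exact ((posSemidef_negLaplacian G hβ T).submatrix _).det_nonneg
    exact nonneg_of_mul_nonneg_right h (by positivity)
  have hpow : (P ^ 2 * D) ^ (3 / 2 : ℝ) = P ^ 3 * (D * √D) := by
    rw [Real.mul_rpow (by positivity) hD0, ← Real.rpow_natCast P 2, ← Real.rpow_mul hP0.le,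
      Real.sqrt_eq_rpow]
    congr 1
    · rw [← Real.rpow_natCast]; norm_num
    · rcases hD0.eq_or_lt with h | h
      · rw [← h]; norm_num
      · rw [← Real.rpow_one_add' hD0 (by norm_num)]; norm_num
  have hprod : ∏ k : {k : V // k ≠ o}, Real.exp (-3 * t k) = (P ^ 3)⁻¹ := by
    rw [hP, ← Finset.prod_pow, ← Finset.prod_inv_distrib]
    refine Finset.prod_congr rfl fun k _ => ?_
    rw [← Real.exp_nat_mul, ← Real.exp_neg]
    congr 1; push_cast; ring
  have hcosh : β * ∑ i, ∑ k ∈ G.neighborFinset i, Real.cosh (T i - T k) = ∑ i, tField w T i := by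
    simp only [Finset.mul_sum, sum_neighborFinset_mul, tField]
    rw [sum_sum_symm fun i k => w i k * Real.exp (T k - T i)]
    refine Finset.sum_congr rfl fun i _ => Finset.sum_congr rfl fun k _ => ?_
    rw [hw, setWeight_comm β _ k i, Real.cosh_eq, neg_sub]
    ring
  have hsum : ∑ i, ∑ k, w i k = 2 * β * G.edgeFinset.card := by
    have h1 : ∀ i, ∑ k, w i k = β * G.degree i := fun i => by
      have := sum_neighborFinset_mul G β (fun _ => 1) i
      simp only [mul_one, Finset.sum_const, SimpleGraph.card_neighborFinset_eq_degree,
        nsmul_eq_mul] at this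
      rw [hw, ← this, mul_comm]
    have h2 : (∑ i, (G.degree i : ℝ)) = 2 * G.edgeFinset.card := by
      exact_mod_cast G.sum_degrees_eq_twice_card_edges
    simp only [h1, ← Finset.mul_sum, h2]
    ring
  unfold density tDensity
  rw [← hT, hcof, hpow, hprod, ← hD, hsum]
  have hexp : Real.exp (-(β / 2) * ∑ i, ∑ k ∈ G.neighborFinset i, Real.cosh (T i - T k)) =
      Real.exp (-β * G.edgeFinset.card) *
        Real.exp (-(1 / 2) * (∑ i, tField w T i - 2 * β * G.edgeFinset.card)) := by
    rw [← Real.exp_add, ← hcosh]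
    congr 1; ring
  rw [hexp]
  field_simp

theorem weightConnected_setWeight {β : ℝ} (hβ : 0 < β) (hG : G.Connected) :
    WeightConnected (setWeight β G.edgeFinset) := by
  intro S hS hS'
  obtain ⟨a, ha⟩ := hS
  obtain ⟨b, hb⟩ : ∃ k, k ∉ S := by
    by_contra! h
    exact hS' (Finset.eq_univ_iff_forall.2 h)
  obtain ⟨p⟩ := hG.preconnected a b
  obtain ⟨d, -, h1, h2⟩ := p.exists_boundary_dart (S : Set V) ha hb
  exact ⟨d.fst, h1, d.snd, h2, by rw [setWeight_edgeFinset, if_pos d.adj]; exact hβ⟩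

theorem gaussConst_eq (o : V) :
    gaussConst o = (2 * Real.pi) ^ (((Fintype.card V : ℝ) - 1) / 2) := by
  have hcard : Fintype.card {k : V // k ≠ o} = Fintype.card V - 1 := by
    simp [Fintype.card_subtype_compl]
  have h1 : 1 ≤ Fintype.card V := Fintype.card_pos_iff.2 ⟨o⟩
  rw [gaussConst, hcard, Real.sqrt_eq_rpow, ← Real.rpow_natCast, ← Real.rpow_mul (by positivity),
    Nat.cast_sub h1]
  congr 1
  push_cast
  ring

theorem integral_exp_mul_density {β : ℝ} (hβ : 0 < β) (hG : G.Connected) (o v l : V) :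
    Integrable (fun t => Real.exp (pin o t l) * density G β o v t) ∧
      ∫ t, Real.exp (pin o t l) * density G β o v t =
        gaussConst o * Real.exp (-β * G.edgeFinset.card) * forestPoly (setWeight β G.edgeFinset)
          (fieldMean (setWeight β G.edgeFinset) l) (Finset.univ.erase o) := by
  set w := setWeight β G.edgeFinset with hw
  have key := integral_det_of_moments (R := Finset.univ.erase o) fun S hS =>
    integral_prod_tField (fun h => Finset.notMem_erase o _ (hS h)) l (setWeight_comm β G.edgeFinset)
      (setWeight_nonneg hβ.le _) (weightConnected_setWeight G hβ hG)
  rw [← hw] at key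
  have hfun : (fun t => Real.exp (pin o t l) * density G β o v t) = fun t =>
      Real.exp (-β * G.edgeFinset.card) * ((Matrix.of fun i => if i ∈ Finset.univ.erase o then
        (Matrix.diagonal (tField w (pin o t)) - Matrix.of w) i else Pi.single i 1 :
          Matrix V V ℝ).det * (Real.exp (pin o t l) * tDensity w o t)) := by
    funext t
    rw [density_eq G hβ.le, ← hw, principalCofactor, ← det_ite_single (· ≠ o)]
    simp only [Finset.mem_erase, Finset.mem_univ, and_true, tMatrix]
    ring
  rw [hfun]
  refine ⟨key.1.const_mul _, ?_⟩
  rw [integral_const_mul, key.2]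
  ring

theorem partitionFunction_eq_forestSum (β : ℝ) :
    partitionFunction G β = forestSum β G.edgeFinset ∅ := by
  classical
  unfold partitionFunction forestSum
  rw [Finset.sum_filter]
  refine Finset.sum_congr rfl fun F hF => ?_
  rw [Finset.mem_powerset] at hF
  simp [weight, IsForest, hF]

open Classical in
/-- The forests that do not connect `o` and `j` are those to which the edge `oj` may be added. -/
theorem sum_weight_connectionEvent (β : ℝ) {o j : V} (hoj : o ≠ j) :
    ∑ F ∈ G.edgeFinset.powerset with F ∈ connectionEvent o j, weight G β F =
      forestSum β G.edgeFinset ∅ - forestSum β G.edgeFinset {s(o, j)} := by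
  rw [← partitionFunction_eq_forestSum, partitionFunction, eq_sub_iff_add_eq,
    ← Finset.sum_filter_add_sum_filter_not G.edgeFinset.powerset (· ∈ connectionEvent o j)]
  congr 1
  rw [forestSum, Finset.sum_filter, Finset.sum_filter]
  refine Finset.sum_congr rfl fun F hF => ?_
  rw [Finset.mem_powerset] at hF
  have h : (Disjoint F {s(o, j)} ∧ (SimpleGraph.fromEdgeSet
      ((F ∪ {s(o, j)} : Finset (Sym2 V)) : Set (Sym2 V))).IsAcyclic) ↔
      F ∉ connectionEvent o j ∧ IsForest G F := by
    rw [Finset.union_comm, ← Finset.insert_eq, fromEdgeSet_insert, Finset.disjoint_singleton_right,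
      SimpleGraph.isAcyclic_sup_fromEdgeSet_iff]
    have hadj : (SimpleGraph.fromEdgeSet (F : Set (Sym2 V))).Adj o j ↔ s(o, j) ∈ F := by
      simp [hoj]
    have hreach : s(o, j) ∈ F → (SimpleGraph.fromEdgeSet (F : Set (Sym2 V))).Reachable o j :=
      fun h => (hadj.2 h).reachable
    rw [hadj, connectionEvent, Set.mem_ofPred_eq, IsForest]
    tauto
  rw [if_congr h rfl rfl]
  by_cases h1 : F ∈ connectionEvent o j <;> by_cases h2 : IsForest G F <;> simp [h1, h2, weight]

theorem forestSum_empty_eq {β : ℝ} (hβ : 0 ≤ β) :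
    forestSum β G.edgeFinset ∅ = expDet (setWeight β G.edgeFinset) := by
  rw [forestSum_eq hβ (fun e he => G.not_isDiag_of_mem_edgeFinset he) ∅ id (by simp) (by simp),
    pushWeight_id]

theorem forestSum_singleton_eq {β : ℝ} (hβ : 0 ≤ β) {o j : V} (hoj : o ≠ j) :
    forestSum β G.edgeFinset {s(o, j)} =
      expDet (pushWeight (mergeMap o j) (setWeight β G.edgeFinset)) := by
  have h : SimpleGraph.fromEdgeSet (({s(o, j)} : Finset (Sym2 V)) : Set (Sym2 V)) =
      SimpleGraph.fromEdgeSet ((∅ : Finset (Sym2 V)) : Set (Sym2 V)) ⊔ SimpleGraph.edge o j := by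
    rw [← fromEdgeSet_insert]; simp
  refine forestSum_eq hβ (fun e he => G.not_isDiag_of_mem_edgeFinset he) _ _ ?_ fun a b => ?_
  · rw [h]
    exact SimpleGraph.IsAcyclic.sup_edge_of_not_reachable (by simp [hoj]) (by simp)
  · rw [h, reachable_sup_edge_iff]
    simp only [Finset.coe_empty, SimpleGraph.fromEdgeSet_empty, SimpleGraph.reachable_bot, mergeMap]
    by_cases ha : a = j <;> by_cases hb : b = j
    · simp [ha, hb]
    · simp [ha, hb, Ne.symm hb, Ne.symm hoj]
    · simp [ha, hb]
    · simp [ha, hb, Ne.symm hb]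

end Laplacian

end ArborealGas

theorem mainTheorem2 {V : Type*} [Fintype V] [DecidableEq V] (G : SimpleGraph V)
    [DecidableRel G.Adj] (hG : G.Connected) (β : ℝ) (hβ : 0 < β) (o j v : V) :
    Integrable (ArborealGas.density G β o v) ∧
    Integrable (fun t => Real.exp (ArborealGas.pin o t j) * ArborealGas.density G β o v t) ∧
    (∫ t, ArborealGas.density G β o v t) =
      (2 * Real.pi) ^ (((Fintype.card V : ℝ) - 1) / 2) * Real.exp (-β * G.edgeFinset.card) *
        ArborealGas.partitionFunction G β ∧
    ArborealGas.prob G β (ArborealGas.connectionEvent o j) =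
      1 / ((2 * Real.pi) ^ (((Fintype.card V : ℝ) - 1) / 2) * Real.exp (-β * G.edgeFinset.card) *
        ArborealGas.partitionFunction G β) *
      ∫ t, Real.exp (ArborealGas.pin o t j) * ArborealGas.density G β o v t := by
  classical
  have hw := ArborealGas.setWeight_comm β G.edgeFinset
  have hw0 := ArborealGas.setWeight_nonneg hβ.le G.edgeFinset
  set w := ArborealGas.setWeight β G.edgeFinset with hwdef
  rw [← ArborealGas.gaussConst_eq o]
  have hZ : ArborealGas.partitionFunction G β =
      ArborealGas.forestPoly w (ArborealGas.fieldMean w o) (Finset.univ.erase o) := by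
    rw [ArborealGas.partitionFunction_eq_forestSum, ArborealGas.forestSum_empty_eq G hβ.le,
      ArborealGas.expDet_eq_erase hw hw0 o]
    refine ArborealGas.forestPoly_congr (fun _ _ _ _ => rfl) fun i hi => ?_
    simp [ArborealGas.fieldMean, Finset.ne_of_mem_erase hi, w]
  obtain ⟨hIo, hEo⟩ := ArborealGas.integral_exp_mul_density G hβ hG o v o
  obtain ⟨hIj, hEj⟩ := ArborealGas.integral_exp_mul_density G hβ hG o v j
  simp only [ArborealGas.pin_self, Real.exp_zero, one_mul] at hIo hEo
  rw [← hwdef, ← hZ] at hEo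
  refine ⟨hIo, hIj, hEo, ?_⟩
  have hne : ArborealGas.gaussConst o * Real.exp (-β * G.edgeFinset.card) ≠ 0 :=
    (mul_pos (ArborealGas.gaussConst_pos o) (Real.exp_pos _)).ne'
  have hnum : ∑ F ∈ G.edgeFinset.powerset with F ∈ ArborealGas.connectionEvent o j,
      ArborealGas.weight G β F =
      ArborealGas.forestPoly w (ArborealGas.fieldMean w j) (Finset.univ.erase o) := by
    rcases eq_or_ne o j with rfl | hoj
    · rw [← hZ, Finset.filter_true_of_mem]
      · rfl
      · exact fun F _ => SimpleGraph.Reachable.refl _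
    · have hj : j ∈ Finset.univ.erase o := by simp [hoj.symm]
      rw [ArborealGas.sum_weight_connectionEvent G β hoj, ArborealGas.forestSum_empty_eq G hβ.le,
        ArborealGas.forestSum_singleton_eq G hβ.le hoj, ← hwdef,
        ArborealGas.expDet_pushWeight_merge hw hw0 hoj, ArborealGas.expDet_eq_erase hw hw0 o,
        ← Finset.insert_erase hj,
        ArborealGas.forestPoly_fieldMean hw (Finset.notMem_erase j _),
        Finset.erase_insert (Finset.notMem_erase j _)]
  rw [hEj, ← hwdef, ← hnum, ArborealGas.prob, one_div_mul_eq_div, mul_div_mul_left _ _ hne]
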